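/- **Setting.** A cube is a cube in $\mathbb R^n$ with sides parallel to the axes, and $|Q|$ is its Lebesgue measure. For $1<r<\infty$ write $r'=r/(r-1)$. Let $M g(x)=\sup_{Q\ni x}\frac1{|Q|}\int_Q|g|$ be the Hardy–Littlewood maximal operator over cubes. For a weight $\sigma$ (a nonnegative measurable function) put $$[\sigma]_{A_\infty}=\sup_Q\frac1{\sigma(Q)}\int_Q M(\sigma\chi_Q)\,dx,\qquad \sigma(Q)=\int_Q\sigma .$$ For $\vec R=(r_1,\dots,r_m)$ with $1<r_i<\infty$, for $t>0$ and for weights $\vec w=(w_1,\dots,w_m)$ put $$[\vec w]_{A_{(\vec R,t)}}=\sup_Q\Big(\frac1{|Q|}\int_Q\Big(\prod_{i=1}^m w_i\Big)^{t}\Big)\prod_{i=1}^m\Big(\frac1{|Q|}\int_Q w_i^{-r_i'}\Big)^{t/r_i'},$$ and write $\vec w\in A_{(\vec R,t)}$ if this is finite. For a kernel $\Omega$ on $(\mathbb R^n)^m$ let $$\mathcal M_{\Omega,\alpha}(\vec f)(x)=\sup_{Q\ni x}\frac1{|Q|^{m-\alpha/n}}\int_{Q^m}|\Omega(x-y_1,\dots,x-y_m)|\prod_{i=1}^m|f_i(y_i)|\,d\vec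 y .$$ **Theorem.** Let $1\le s'<p_i<\infty$ for $i=1,\dots,m$, let $s\in(1,\infty]$ be the exponent with $\frac1s+\frac1{s'}=1$, and let $\frac1p=\sum_{i=1}^m\frac1{p_i}$, $0<\alpha<mn$, $\frac1m<p<\frac n\alpha$, $\frac1q=\frac1p-\frac\alpha n$, $\vec P=(p_1,\dots,p_m)$. There is a constant $C$, depending only on $m,n,\vec P,q,s$, such that the following holds. Let $\vec\omega=(\omega_1,\dots,\omega_m)$ be nonnegative, finite-valued measurable functions on $\mathbb R^n$ for which $\vec\omega^{s'}=(\omega_1^{s'},\dots,\omega_m^{s'})$ belongs to $A_{(\vec P/s',\,q/s')}$, where $\vec P/s'=(p_1/s',\dots,p_m/s')$, and let $\nu_{\vec\omega}=\prod_{i=1}^m\omega_i$. Let $f_1,\dots,f_m$ be measurable functions on $\mathbb R^n$. Let $\Omega$ and $\|\Omega\|_{L^s}$ be as in one of the following two cases: * (a) $\Omega(\lambda_1y_1,\dots,\lambda_my_m)=\Omega(y_1,\dots,y_m)$ for all $\lambda_1,\dots,\lambda_m>0$ and all nonzero $y_1,\dots,y_m\in\mathbb R^n$, the restriction of $\Omega$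 to $(S^{n-1})^m$ is in $L^s((S^{n-1})^m)$, and $\|\Omega\|_{L^s}=\|\Omega\|_{L^s((S^{n-1})^m)}$; * (b) $\Omega(\lambda y_1,\dots,\lambda y_m)=\Omega(y_1,\dots,y_m)$ for all $\lambda>0$ and all $y_1,\dots,y_m\in\mathbb R^n$, the restriction of $\Omega$ to the unit sphere $S^{mn-1}$ of $(\mathbb R^n)^m=\mathbb R^{mn}$ is in $L^s(S^{mn-1})$, and $\|\Omega\|_{L^s}=\|\Omega\|_{L^s(S^{mn-1})}$. Then $$\|\mathcal M_{\Omega,\alpha}(\vec f)\|_{L^q(\nu_{\vec\omega}^q)}\le C\,\|\Omega\|_{L^s}\,[\vec\omega^{s'}]_{A_{(\vec P/s',\,q/s')}}^{1/q}\,\prod_{i=1}^m\big[(\omega_i^{s'})^{-(p_i/s')'}\big]_{A_\infty}^{1/p_i}\,\prod_{i=1}^m\|f_i\|_{L^{p_i}(\omega_i^{p_i})},$$ where $\|g\|_{L^r(w)}=\big(\int|g|^r w\,dx\big)^{1/r}$, and both sides are read in $[0,\infty]$ with $0\cdot\infty=0$. -/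

import Mathlib

open MeasureTheory
open scoped ENNReal NNReal

noncomputable section

namespace RoughFractional

/-- The Euclidean space `ℝⁿ`. -/
abbrev E (n : ℕ) : Type := EuclideanSpace ℝ (Fin n)

/-- `Q` is a (closed, nondegenerate) cube in `ℝⁿ` with sides parallel to the axes. -/
def IsCube {n : ℕ} (Q : Set (E n)) : Prop :=
  ∃ (a : E n) (l : ℝ), 0 < l ∧ Q = {y : E n | ∀ j, a j ≤ y j ∧ y j ≤ a j + l}

/-- The average `|Q|⁻¹ ∫_Q g`. -/
def avg {n : ℕ} (Q : Set (E n)) (g : E n → ℝ≥0∞) : ℝ≥0∞ :=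
  (∫⁻ y in Q, g y) / volume Q

/-- The (uncentered, cubic) Hardy-Littlewood maximal function of a nonnegative function. -/
def hardyLittlewood {n : ℕ} (g : E n → ℝ≥0∞) (x : E n) : ℝ≥0∞ :=
  ⨆ (Q : Set (E n)) (_ : IsCube Q) (_ : x ∈ Q), avg Q g

/-- The (Fujii-Wilson) `A_∞` constant `sup_Q σ(Q)⁻¹ ∫_Q M(σ χ_Q)` of a weight `σ`. -/
def AInftyConst {n : ℕ} (σ : E n → ℝ≥0∞) : ℝ≥0∞ :=
  ⨆ (Q : Set (E n)) (_ : IsCube Q),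
    (∫⁻ x in Q, hardyLittlewood (Q.indicator σ) x) / ∫⁻ x in Q, σ x

/-- The constant `[w]_{A_{(P,q)}}` of a vector weight `w = (w₁, …, w_m)`, for exponents `P i > 1`
and `q > 0`:
`sup_Q (avg_Q (∏ᵢ wᵢ)^q) ∏ᵢ (avg_Q wᵢ^{-pᵢ'})^{q/pᵢ'}`, where `pᵢ' = pᵢ / (pᵢ - 1)`. -/
def APqConst {m n : ℕ} (P : Fin m → ℝ) (q : ℝ) (w : Fin m → E n → ℝ≥0∞) : ℝ≥0∞ :=
  ⨆ (Q : Set (E n)) (_ : IsCube Q),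
    avg Q (fun x => (∏ i, w i x) ^ q) *
      ∏ i, avg Q (fun x => w i x ^ (-(P i).conjExponent)) ^ (q / (P i).conjExponent)

/-- The weight class `A_{(P,q)}`. -/
def MemAPq {m n : ℕ} (P : Fin m → ℝ) (q : ℝ) (w : Fin m → E n → ℝ≥0∞) : Prop :=
  APqConst P q w < ∞

/-- The multilinear fractional maximal function with rough kernel `Ω`:
`sup_{Q ∋ x} |Q|^{-(m - α/n)} ∫_{Q^m} |Ω(x - y₁, …, x - y_m)| ∏ᵢ |fᵢ(yᵢ)| dy`. -/
def roughMaximal {m n : ℕ} (Ω : (Fin m → E n) → ℂ) (α : ℝ) (f : Fin m → E n → ℂ) (x : E n) :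
    ℝ≥0∞ :=
  ⨆ (Q : Set (E n)) (_ : IsCube Q) (_ : x ∈ Q),
    (∫⁻ y in Set.univ.pi (fun _ : Fin m => Q),
        ‖Ω (fun i => x - y i)‖ₑ * ∏ i, ‖f i (y i)‖ₑ) /
      volume Q ^ ((m : ℝ) - α / n)

/-- The weighted (quasi)norm `(∫ g^p w dx)^{1/p}` of a nonnegative function `g`. -/
def weightedLpNorm {n : ℕ} (p : ℝ) (g : E n → ℝ≥0∞) (w : E n → ℝ≥0∞) : ℝ≥0∞ :=
  (∫⁻ x, g x ^ p * w x) ^ (1 / p)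

/-- `Ω` is homogeneous of degree zero in each of its `m` variables (away from zero), i.e. it is
the canonical extension to `(ℝⁿ)^m` of a function on the product of spheres `(S^{n-1})^m`. -/
def SeparatelyHomogeneous {m n : ℕ} (Ω : (Fin m → E n) → ℂ) : Prop :=
  ∀ (l : Fin m → ℝ) (y : Fin m → E n), (∀ i, 0 < l i) → (∀ i, y i ≠ 0) →
    Ω (fun i => l i • y i) = Ω y

/-- `Ω` is homogeneous of degree zero under simultaneous dilations of its `m` variables, i.e. it
is the canonical extension to `(ℝⁿ)^m` of a function on the unit sphere `S^{mn-1}`. -/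
def JointlyHomogeneous {m n : ℕ} (Ω : (Fin m → E n) → ℂ) : Prop :=
  ∀ (l : ℝ) (y : Fin m → E n), 0 < l → Ω (fun i => l • y i) = Ω y

/-- The restriction of `Ω` to `(S^{n-1})^m`. -/
def onProdSphere {m n : ℕ} (Ω : (Fin m → E n) → ℂ) :
    (Fin m → Metric.sphere (0 : E n) 1) → ℂ :=
  fun θ => Ω (fun i => (θ i : E n))

/-- The product of the surface measures on `(S^{n-1})^m`. -/
def prodSphereMeasure (m n : ℕ) : Measure (Fin m → Metric.sphere (0 : E n) 1) :=
  Measure.pi fun _ => (volume : Measure (E n)).toSphere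

/-- `(ℝⁿ)^m = ℝ^{mn}` with its Euclidean norm `|y| = (|y₁|² + ⋯ + |y_m|²)^{1/2}`. -/
abbrev EProd (m n : ℕ) : Type := PiLp 2 (fun _ : Fin m => E n)

/-- The restriction of `Ω` to the unit sphere `S^{mn-1}` of `(ℝⁿ)^m = ℝ^{mn}`. -/
def onJointSphere {m n : ℕ} (Ω : (Fin m → E n) → ℂ) :
    Metric.sphere (0 : EProd m n) 1 → ℂ :=
  fun θ => Ω (fun i => (θ : EProd m n) i)

/-- The surface measure on the unit sphere `S^{mn-1}` of `(ℝⁿ)^m = ℝ^{mn}`. -/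
def jointSphereMeasure (m n : ℕ) : Measure (Metric.sphere (0 : EProd m n) 1) :=
  (volume : Measure (EProd m n)).toSphere

end RoughFractional

end

/-!
The proof has two parts.

*Reduction to the fractional maximal function.* For `x ∈ Q`, Hölder's inequality on `Q^m` with the
exponents `s` and `s'` separates the kernel from the functions. Since `Ω` is homogeneous of degree
zero, polar coordinates bound its `L^s` norm on a product of balls of radius `l` by
`l^{mn/s} ‖Ω‖_{L^s}`; in both cases this is obtained from the fact that `y ↦ y / |y|` sends Lebesgue
measure on a ball to a multiple of the surface measure (`measurePreserving_direction`). What remains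
is `‖Ω‖_{L^s}` times the power `1 / s'` of the fractional maximal function of the functions
`|fᵢ|^{s'}` (`roughMaximal_le`), and the powers `ωᵢ^{s'}` of the weights turn the statement into the
case `s' = 1` without kernel.

*The mixed bound for the fractional maximal function* (`weightedLpNorm_fractionalMaximal_le`). By
the one-third trick (`IsCube.exists_cell`), it suffices to consider the cubes of finitely many
grids. On one grid, the root `Φ Q` of order `γ = m - α / n` of the quantity
`|Q|^{-γ} ∏ ∫_Q gᵢ` has the property that `|Q| Φ Q` is superadditive over disjoint cubes, so
the cubes that are maximal with `Φ > 2 ^ k`, for some `k`, form a sparse family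
(`NestedGrid.measure_cell_le_two_mul_core`,
`NestedGrid.tsum_indicator_core_le`), and the `q`-th power of the maximal function is dominated by a
sum over this family. With `σᵢ = wᵢ^{-Pᵢ'}`, the joint weight condition bounds the term of a cube
`Q` by the product of the numbers `(⟨gᵢ / σᵢ⟩_{Q, σᵢ}^{Pᵢ} σᵢ(Q))^{q / Pᵢ}`, where `⟨·⟩_{Q, σᵢ}` is
the mean over `Q` with respect to `σᵢ`. As `∑ q / Pᵢ ≥ 1`, Hölder's inequality for sums
(`tsum_prod_rpow_le`) reduces the estimate to one weight at a time. There the Carleson embedding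
theorem (`NestedGrid.carleson_embedding`) applies, because sparseness and the definition of the
`A_∞` constant give the packing condition `∑_{Q ⊆ R} σᵢ(Q) ≤ 4 [σᵢ]_{A_∞} σᵢ(R)` over the sparse
family (`NestedGrid.tsum_stopping_le`).

All estimates are carried out in `[0, ∞]`. If some `σᵢ` is not locally integrable, then the product
of the weights vanishes almost everywhere and there is nothing to prove
(`ae_prod_weight_eq_zero`).
-/

noncomputable section

namespace RoughFractional

/-! ### Inequalities in `[0, ∞]` -/

/-- Superadditivity of `x ↦ x ^ r`, `r ≥ 1`, for infinite sums. -/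
lemma tsum_rpow_le_rpow_tsum {κ : Type*} (x : κ → ℝ≥0∞) {r : ℝ} (hr : 1 ≤ r) :
    ∑' k, x k ^ r ≤ (∑' k, x k) ^ r := by
  have split : ∀ y : ℝ≥0∞, y ^ r = y * y ^ (r - 1) := fun y => by
    have h := ENNReal.rpow_add_of_nonneg (x := y) 1 (r - 1) zero_le_one (by linarith)
    rw [ENNReal.rpow_one] at h
    rw [← h]
    congr 1
    ring
  calc ∑' k, x k ^ r = ∑' k, x k * x k ^ (r - 1) := tsum_congr fun k => split _
    _ ≤ ∑' k, x k * (∑' k, x k) ^ (r - 1) := ENNReal.tsum_le_tsum fun k => by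
        gcongr _ * ?_
        exact ENNReal.rpow_le_rpow (ENNReal.le_tsum k) (by linarith)
    _ = (∑' k, x k) ^ r := by rw [ENNReal.tsum_mul_right, ← split]

/-- Hölder's inequality for sums of products, with exponents whose sum is at least one. -/
lemma tsum_prod_rpow_le {κ : Type*} {m : ℕ} (x : Fin m → κ → ℝ≥0∞) (θ : Fin m → ℝ)
    (hθ : ∀ i, 0 ≤ θ i) (hsum : 1 ≤ ∑ i, θ i) :
    ∑' k, ∏ i, x i k ^ θ i ≤ ∏ i, (∑' k, x i k) ^ θ i := by
  let : MeasurableSpace κ := ⊤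
  have : DiscreteMeasurableSpace κ := ⟨fun _ => trivial⟩
  set T := ∑ i, θ i with hT
  have hT0 : 0 < T := by linarith
  have hθT : ∀ (y : ℝ≥0∞) i, (y ^ (θ i / T)) ^ T = y ^ θ i := fun y i => by
    rw [← ENNReal.rpow_mul, div_mul_cancel₀ _ hT0.ne']
  have holder : ∑' k, ∏ i, x i k ^ (θ i / T) ≤ ∏ i, (∑' k, x i k) ^ (θ i / T) := by
    have := ENNReal.lintegral_prod_norm_pow_le (μ := (Measure.count : Measure κ)) Finset.univ
      (f := x) (fun i _ => (Measurable.of_discrete).aemeasurable) (p := fun i => θ i / T)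
      (by rw [← Finset.sum_div, ← hT, div_self hT0.ne']) (fun i _ => div_nonneg (hθ i) hT0.le)
    simpa only [lintegral_count] using this
  calc ∑' k, ∏ i, x i k ^ θ i = ∑' k, (∏ i, x i k ^ (θ i / T)) ^ T := by
        refine tsum_congr fun k => ?_
        rw [← ENNReal.prod_rpow_of_nonneg hT0.le]
        exact Finset.prod_congr rfl fun i _ => (hθT _ i).symm
    _ ≤ (∑' k, ∏ i, x i k ^ (θ i / T)) ^ T := tsum_rpow_le_rpow_tsum _ hsum
    _ ≤ (∏ i, (∑' k, x i k) ^ (θ i / T)) ^ T := by gcongr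
    _ = ∏ i, (∑' k, x i k) ^ θ i := by
        rw [← ENNReal.prod_rpow_of_nonneg hT0.le]
        exact Finset.prod_congr rfl fun i _ => hθT _ i

/-- The layer-cake formula for a power of a number in `[0, ∞]`. -/
lemma lintegral_rpow_layer {r : ℝ} (hr : 0 < r) (x : ℝ≥0∞) :
    ∫⁻ t in Set.Ioi (0 : ℝ), (if ENNReal.ofReal t < x then ENNReal.ofReal (t ^ (r - 1)) else 0)
      = x ^ r / ENNReal.ofReal r := by
  have hfin : ∀ y : ℝ, 0 ≤ y → ∫⁻ t in Set.Ioo (0 : ℝ) y, ENNReal.ofReal (t ^ (r - 1))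
      = ENNReal.ofReal y ^ r / ENNReal.ofReal r := by
    intro y hy
    have hint : IntervalIntegrable (fun t : ℝ => t ^ (r - 1)) volume 0 y :=
      intervalIntegral.intervalIntegrable_rpow' (by linarith)
    rw [setLIntegral_congr Ioo_ae_eq_Ioc, ← ofReal_integral_eq_lintegral_ofReal,
      ← intervalIntegral.integral_of_le hy, integral_rpow (Or.inl (by linarith)),
      ENNReal.ofReal_rpow_of_nonneg hy hr.le, ← ENNReal.ofReal_div_of_pos hr]
    · congr 1
      simp [Real.zero_rpow hr.ne']
    · exact (intervalIntegrable_iff_integrableOn_Ioc_of_le hy).1 hint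
    · exact (ae_restrict_mem measurableSet_Ioc).mono fun t ht => Real.rpow_nonneg ht.1.le _
  have hind : ∀ y : ℝ, ∫⁻ t in Set.Ioi (0 : ℝ),
      (if t < y then ENNReal.ofReal (t ^ (r - 1)) else 0)
      = ∫⁻ t in Set.Ioo (0 : ℝ) y, ENNReal.ofReal (t ^ (r - 1)) := by
    intro y
    rw [← Set.Ioi_inter_Iio, Set.inter_comm, ← Measure.restrict_restrict measurableSet_Iio,
      ← lintegral_indicator measurableSet_Iio]
    rfl
  induction x using ENNReal.recTopCoe with
  | top =>
    -- The integral over `(0, ∞)` exceeds the integral up to `(c r) ^ (1 / r)`, which equals `c`.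
    simp only [ENNReal.ofReal_lt_top, if_true]
    rw [ENNReal.top_rpow_of_pos hr, ENNReal.top_div_of_ne_top ENNReal.ofReal_ne_top]
    refine ENNReal.eq_top_of_forall_nnreal_le fun c => ?_
    have hy : (0 : ℝ) ≤ (c * r) ^ (1 / r) := by positivity
    calc (c : ℝ≥0∞) = ENNReal.ofReal ((c * r) ^ (1 / r)) ^ r / ENNReal.ofReal r := by
          rw [ENNReal.ofReal_rpow_of_nonneg hy hr.le, ← Real.rpow_mul (by positivity),
            one_div_mul_cancel hr.ne', Real.rpow_one, ← ENNReal.ofReal_div_of_pos hr,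
            mul_div_cancel_right₀ _ hr.ne', ENNReal.ofReal_coe_nnreal]
      _ = _ := (hfin _ hy).symm
      _ ≤ _ := lintegral_mono_set Set.Ioo_subset_Ioi_self
  | coe x =>
    rw [← ENNReal.ofReal_coe_nnreal, ← hfin _ x.coe_nonneg, ← hind]
    refine setLIntegral_congr_fun measurableSet_Ioi fun t ht => ?_
    simp only [ENNReal.ofReal_lt_ofReal_iff_of_nonneg (le_of_lt ht)]

/-! ### Nested grids and their maximal cells -/

/-- A sequence of countable measurable partitions of `X`, each refining the preceding one. The
partition at level `j` is given by the labelling function `idx j`, whose fibres are the cells. -/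
structure NestedGrid (X ι : Type*) [MeasurableSpace X] where
  /-- The label of the cell of level `j` that contains a given point. -/
  idx : ℕ → X → ι
  measurableSet_fiber : ∀ j v, MeasurableSet {x | idx j x = v}
  idx_eq_of_succ : ∀ j x y, idx (j + 1) x = idx (j + 1) y → idx j x = idx j y

namespace NestedGrid

variable {X ι : Type*} [MeasurableSpace X] (G : NestedGrid X ι)

/-- The cell with level `c.1` and label `c.2`; it may be empty. -/
def cell (c : ℕ × ι) : Set X := {x | G.idx c.1 x = c.2}

/-- The cell of level `j` containing `x`. -/
def cellAt (j : ℕ) (x : X) : ℕ × ι := (j, G.idx j x)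

/-- The maximal cells of a family `A`: no point of such a cell lies in a cell of `A` of a
coarser level. -/
def top (A : Set (ℕ × ι)) : Set (ℕ × ι) :=
  {c | c ∈ A ∧ ∀ x ∈ G.cell c, ∀ i < c.1, G.cellAt i x ∉ A}

lemma measurableSet_cell (c : ℕ × ι) : MeasurableSet (G.cell c) := G.measurableSet_fiber _ _

lemma mem_cell_cellAt (j : ℕ) (x : X) : x ∈ G.cell (G.cellAt j x) := rfl

lemma cellAt_eq {c : ℕ × ι} {x : X} (hx : x ∈ G.cell c) : G.cellAt c.1 x = c :=
  Prod.ext rfl hx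

lemma idx_eq_of_le {i j : ℕ} (hij : i ≤ j) {x y : X} (h : G.idx j x = G.idx j y) :
    G.idx i x = G.idx i y := by
  induction j, hij using Nat.le_induction with
  | base => exact h
  | succ k _ ih => exact ih (G.idx_eq_of_succ _ _ _ h)

lemma cellAt_eq_of_le {i : ℕ} {c : ℕ × ι} (hi : i ≤ c.1) {x y : X} (hx : x ∈ G.cell c)
    (hy : y ∈ G.cell c) : G.cellAt i x = G.cellAt i y :=
  Prod.ext rfl (G.idx_eq_of_le hi (Eq.trans hx (Eq.symm hy)))

lemma cell_subset {c d : ℕ × ι} {x : X} (hc : x ∈ G.cell c) (hd : x ∈ G.cell d)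
    (h : d.1 ≤ c.1) : G.cell c ⊆ G.cell d := fun y hy => by
  have := G.cellAt_eq_of_le h hc hy
  rw [G.cellAt_eq hd] at this
  rw [this]
  exact G.mem_cell_cellAt _ _

lemma eq_of_mem_top {A : Set (ℕ × ι)} {c d : ℕ × ι} (hc : c ∈ G.top A) (hd : d ∈ G.top A)
    {x : X} (hxc : x ∈ G.cell c) (hxd : x ∈ G.cell d) : c = d := by
  rw [← G.cellAt_eq hxc, ← G.cellAt_eq hxd]
  rcases lt_trichotomy c.1 d.1 with h | h | h
  · exact absurd (by rw [G.cellAt_eq hxc]; exact hc.1) (hd.2 x hxd _ h)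
  · rw [h]
  · exact absurd (by rw [G.cellAt_eq hxd]; exact hd.1) (hc.2 x hxc _ h)

lemma exists_mem_top {A : Set (ℕ × ι)} {c : ℕ × ι} (hc : c ∈ A) {x : X} (hx : x ∈ G.cell c) :
    ∃ d ∈ G.top A, x ∈ G.cell d ∧ G.cell c ⊆ G.cell d := by
  classical
  have hex : ∃ j, G.cellAt j x ∈ A := ⟨c.1, by rwa [G.cellAt_eq hx]⟩
  refine ⟨G.cellAt (Nat.find hex) x, ⟨Nat.find_spec hex, fun y hy i hi => ?_⟩, rfl, ?_⟩
  · rw [← G.cellAt_eq_of_le hi.le (G.mem_cell_cellAt _ x) hy]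
    exact Nat.find_min hex hi
  · exact G.cell_subset hx rfl (Nat.find_min' hex (by rwa [G.cellAt_eq hx]))

lemma pairwise_disjoint_top (A : Set (ℕ × ι)) :
    Pairwise (Function.onFun Disjoint fun c : G.top A => G.cell c) := fun c d hcd =>
  Set.disjoint_left.2 fun _ hxc hxd => hcd (Subtype.ext (G.eq_of_mem_top c.2 d.2 hxc hxd))

variable [Countable ι]

lemma tsum_lintegral_top (A : Set (ℕ × ι)) (μ : Measure X) (f : X → ℝ≥0∞) :
    ∑' c : G.top A, ∫⁻ x in G.cell c, f x ∂μ = ∫⁻ x in ⋃ c : G.top A, G.cell c, f x ∂μ :=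
  (lintegral_iUnion (fun c : G.top A => G.measurableSet_cell c) (G.pairwise_disjoint_top A) f).symm

lemma tsum_measure_top (A : Set (ℕ × ι)) (μ : Measure X) :
    ∑' c : G.top A, μ (G.cell c) = μ (⋃ c : G.top A, G.cell c) :=
  (measure_iUnion (G.pairwise_disjoint_top A) fun c : G.top A => G.measurableSet_cell c).symm

/-! ### The Carleson embedding theorem -/

/-- If the mean of `h` over a cell exceeds `t`, then the part of `h` above `t / 2` carries at
least half of it. -/
lemma ofReal_mul_measure_le (μ : Measure X) {h : X → ℝ≥0∞} {t : ℝ}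
    {c : Set X} (hfin : μ c ≠ ∞) (hc : ENNReal.ofReal t < (∫⁻ x in c, h x ∂μ) / μ c) :
    ENNReal.ofReal t * μ c ≤
      2 * ∫⁻ x in c, (if ENNReal.ofReal t < 2 * h x then h x else 0) ∂μ := by
  set τ := ENNReal.ofReal t
  have hτ : τ / 2 ≠ ∞ := ENNReal.div_ne_top ENNReal.ofReal_ne_top two_ne_zero
  have h1 := (ENNReal.mul_lt_of_lt_div hc).le
  have h2 : ∫⁻ x in c, h x ∂μ ≤
      (∫⁻ x in c, (if τ < 2 * h x then h x else 0) ∂μ) + τ / 2 * μ c := by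
    rw [← setLIntegral_const, ← lintegral_add_right _ measurable_const]
    refine lintegral_mono fun x => ?_
    split_ifs with hx
    · exact le_self_add
    · rw [zero_add, ENNReal.le_div_iff_mul_le (by simp) (by simp), mul_comm]
      exact not_lt.1 hx
  have h3 : τ * μ c = τ / 2 * μ c + τ / 2 * μ c := by rw [← add_mul, ENNReal.add_halves]
  have h4 : τ / 2 * μ c ≤ ∫⁻ x in c, (if τ < 2 * h x then h x else 0) ∂μ := by
    refine (ENNReal.add_le_add_iff_right (ENNReal.mul_ne_top hτ hfin)).1 ?_
    rw [← h3]
    exact h1.trans h2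
  rw [h3, two_mul]
  exact add_le_add h4 h4

lemma tsum_level_le (μ : Measure X) {h : X → ℝ≥0∞}
    (hfin : ∀ Q, μ (G.cell Q) ≠ ∞) (c : ℕ × ι → ℝ≥0∞) (Λ : ℝ≥0∞)
    (hc : ∀ R, ∑' Q : {Q | G.cell Q ⊆ G.cell R}, c Q ≤ Λ * μ (G.cell R)) {t : ℝ} (ht : 0 < t) :
    ∑' Q : {Q | ENNReal.ofReal t < (∫⁻ x in G.cell Q, h x ∂μ) / μ (G.cell Q)}, c Q ≤
      Λ * ((2 / ENNReal.ofReal t) *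
        ∫⁻ x, (if ENNReal.ofReal t < 2 * h x then h x else 0) ∂μ) := by
  set A : Set (ℕ × ι) :=
    {Q | ENNReal.ofReal t < (∫⁻ x in G.cell Q, h x ∂μ) / μ (G.cell Q)} with hA
  have ht0 : ENNReal.ofReal t ≠ 0 := by simpa using ht
  have hcover : A ⊆ ⋃ R : G.top A, {Q | G.cell Q ⊆ G.cell R} := by
    intro Q hQ
    have hne : (G.cell Q).Nonempty := by
      by_contra hempty
      rw [Set.not_nonempty_iff_eq_empty] at hempty
      simp [hA, hempty] at hQ
    obtain ⟨x, hx⟩ := hne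
    obtain ⟨R, hR, -, hQR⟩ := G.exists_mem_top hQ hx
    exact Set.mem_iUnion.2 ⟨⟨R, hR⟩, hQR⟩
  calc ∑' Q : A, c Q ≤ ∑' Q : (⋃ R : G.top A, {Q | G.cell Q ⊆ G.cell R} : Set (ℕ × ι)), c Q :=
        ENNReal.tsum_mono_subtype _ hcover
    _ ≤ ∑' R : G.top A, ∑' Q : {Q | G.cell Q ⊆ G.cell R}, c Q := ENNReal.tsum_iUnion_le_tsum _ _
    _ ≤ ∑' R : G.top A, Λ * μ (G.cell R) := ENNReal.tsum_le_tsum fun R => hc R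
    _ ≤ ∑' R : G.top A, Λ * ((2 / ENNReal.ofReal t) *
          ∫⁻ x in G.cell R, (if ENNReal.ofReal t < 2 * h x then h x else 0) ∂μ) := by
        refine ENNReal.tsum_le_tsum fun R => mul_le_mul_right ?_ Λ
        have := ofReal_mul_measure_le μ (hfin R) R.2.1
        rw [ENNReal.mul_comm_div, ← mul_div_assoc, ENNReal.le_div_iff_mul_le (Or.inl ht0)
          (Or.inl ENNReal.ofReal_ne_top), mul_comm]
        exact this
    _ ≤ _ := by
        rw [ENNReal.tsum_mul_left, ENNReal.tsum_mul_left, tsum_lintegral_top]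
        gcongr
        exact Measure.restrict_le_self

/-- The Carleson embedding theorem: if the numbers `c Q` satisfy a packing condition with
constant `Λ` relative to `μ`, then they are dominated in the sense of `L^p` means. -/
theorem carleson_embedding (μ : Measure X) [SFinite μ] {h : X → ℝ≥0∞} (hh : Measurable h)
    (hfin : ∀ Q, μ (G.cell Q) ≠ ∞) (c : ℕ × ι → ℝ≥0∞) (Λ : ℝ≥0∞)
    (hc : ∀ R, ∑' Q : {Q | G.cell Q ⊆ G.cell R}, c Q ≤ Λ * μ (G.cell R)) {p : ℝ} (hp : 1 < p) :
    ∑' Q, c Q * ((∫⁻ x in G.cell Q, h x ∂μ) / μ (G.cell Q)) ^ p ≤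
      ENNReal.ofReal (p * 2 ^ p / (p - 1)) * Λ * ∫⁻ x, h x ^ p ∂μ := by
  set a : ℕ × ι → ℝ≥0∞ := fun Q => (∫⁻ x in G.cell Q, h x ∂μ) / μ (G.cell Q) with ha
  have hp0 : 0 < p := by linarith
  have hpr : ENNReal.ofReal p ≠ 0 := by simpa using hp0
  have layer : ∀ x : ℝ≥0∞, x ^ p = ENNReal.ofReal p * ∫⁻ t in Set.Ioi (0 : ℝ),
      (if ENNReal.ofReal t < x then ENNReal.ofReal (t ^ (p - 1)) else 0) := fun x => by
    rw [lintegral_rpow_layer hp0, ENNReal.mul_div_cancel hpr ENNReal.ofReal_ne_top]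
  have hmeas : ∀ x : ℝ≥0∞, Measurable fun t : ℝ =>
      (if ENNReal.ofReal t < x then ENNReal.ofReal (t ^ (p - 1)) else 0) := fun x =>
    Measurable.ite (measurableSet_lt ENNReal.measurable_ofReal measurable_const)
      (by fun_prop) measurable_const
  calc ∑' Q, c Q * a Q ^ p
      = ENNReal.ofReal p * ∫⁻ t in Set.Ioi (0 : ℝ), ∑' Q, c Q *
          (if ENNReal.ofReal t < a Q then ENNReal.ofReal (t ^ (p - 1)) else 0) := by
        rw [lintegral_tsum fun Q => ((hmeas _).const_mul _).aemeasurable, ← ENNReal.tsum_mul_left]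
        refine tsum_congr fun Q => ?_
        rw [lintegral_const_mul _ (hmeas _), layer, mul_left_comm]
    _ ≤ ENNReal.ofReal p * ∫⁻ t in Set.Ioi (0 : ℝ), ENNReal.ofReal (t ^ (p - 1)) *
          (Λ * ((2 / ENNReal.ofReal t) *
            ∫⁻ x, (if ENNReal.ofReal t < 2 * h x then h x else 0) ∂μ)) := by
        refine mul_le_mul_right (setLIntegral_mono' measurableSet_Ioi fun t ht => ?_) _
        refine le_trans (le_of_eq ?_) (mul_le_mul_right (G.tsum_level_le μ hfin c Λ hc ht) _)
        rw [tsum_subtype, ← ENNReal.tsum_mul_left]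
        refine tsum_congr fun Q => ?_
        by_cases hQ : ENNReal.ofReal t < a Q
        · rw [if_pos hQ, Set.indicator_of_mem (by exact hQ), mul_comm]
        · rw [if_neg hQ, Set.indicator_of_notMem (by exact hQ), mul_zero, mul_zero]
    _ = ENNReal.ofReal p * ∫⁻ t in Set.Ioi (0 : ℝ), ∫⁻ x, Λ * (2 * (h x *
          (if ENNReal.ofReal t < 2 * h x then ENNReal.ofReal (t ^ ((p - 1) - 1)) else 0))) ∂μ := by
        congr 1
        refine setLIntegral_congr_fun measurableSet_Ioi fun t ht => ?_
        have ht : 0 < t := ht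
        have hm : Measurable fun x => (if ENNReal.ofReal t < 2 * h x then h x else 0) :=
          Measurable.ite (measurableSet_lt measurable_const (by fun_prop)) hh measurable_const
        have e1 : ENNReal.ofReal (t ^ (p - 1)) * (2 / ENNReal.ofReal t) =
            2 * ENNReal.ofReal (t ^ ((p - 1) - 1)) := by
          rw [Real.rpow_sub_one ht.ne' (p - 1), ENNReal.ofReal_div_of_pos ht,
            ENNReal.div_eq_inv_mul,
            ENNReal.div_eq_inv_mul]
          ring
        rw [← lintegral_const_mul _ hm, ← lintegral_const_mul _ (by fun_prop),
          ← lintegral_const_mul _ (by fun_prop)]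
        refine lintegral_congr fun x => ?_
        rw [mul_left_comm, ← mul_assoc (ENNReal.ofReal _), e1]
        split_ifs <;> ring
    _ = ENNReal.ofReal p * (Λ * (2 * ∫⁻ x, h x * ((2 * h x) ^ (p - 1) / ENNReal.ofReal (p - 1))
          ∂μ)) := by
        have hjoint : Measurable fun z : ℝ × X =>
            (if ENNReal.ofReal z.1 < 2 * h z.2 then ENNReal.ofReal (z.1 ^ ((p - 1) - 1)) else 0) :=
          Measurable.ite (measurableSet_lt (by fun_prop) (by fun_prop)) (by fun_prop)
            measurable_const
        congr 1
        rw [lintegral_lintegral_swap 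
          ((((hh.comp measurable_snd).mul hjoint).const_mul 2).const_mul Λ).aemeasurable]
        rw [← lintegral_const_mul _ (by fun_prop), ← lintegral_const_mul _ (by fun_prop)]
        refine lintegral_congr fun x => ?_
        have hs : Measurable fun t : ℝ =>
            (if ENNReal.ofReal t < 2 * h x then ENNReal.ofReal (t ^ ((p - 1) - 1)) else 0) :=
          hjoint.comp (measurable_id.prodMk measurable_const)
        rw [lintegral_const_mul _ (by fun_prop), lintegral_const_mul _ (by fun_prop),
          lintegral_const_mul _ hs, lintegral_rpow_layer (by linarith)]
    _ = _ := by
        have hp1 : 0 < p - 1 := by linarith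
        have e2 : ∀ x, h x * ((2 * h x) ^ (p - 1) / ENNReal.ofReal (p - 1)) =
            ENNReal.ofReal (2 ^ (p - 1) / (p - 1)) * h x ^ p := fun x => by
          have e3 : h x ^ p = h x * h x ^ (p - 1) := by
            have := ENNReal.rpow_add_of_nonneg (x := h x) 1 (p - 1) zero_le_one hp1.le
            rw [ENNReal.rpow_one] at this
            rw [← this]
            congr 1
            ring
          rw [ENNReal.mul_rpow_of_nonneg _ _ hp1.le, ENNReal.ofReal_div_of_pos hp1, e3,
            ← ENNReal.ofReal_rpow_of_pos two_pos, ENNReal.div_eq_inv_mul, ENNReal.div_eq_inv_mul,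
            ENNReal.ofReal_ofNat]
          ring
        have e4 : ENNReal.ofReal (p * 2 ^ p / (p - 1)) =
            ENNReal.ofReal p * 2 * ENNReal.ofReal (2 ^ (p - 1) / (p - 1)) := by
          rw [← ENNReal.ofReal_ofNat 2, ← ENNReal.ofReal_mul hp0.le,
            ← ENNReal.ofReal_mul (by positivity),
            Real.rpow_sub_one two_ne_zero]
          congr 1
          ring
        simp only [e2]
        rw [lintegral_const_mul _ (by fun_prop), e4]
        ring

end NestedGrid

namespace NestedGrid

variable {X ι : Type*} [MeasurableSpace X] (G : NestedGrid X ι)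

/-! ### The sparse family of stopping cells -/

/-- The cells that are maximal among those with `Φ > 2 ^ k`, for some integer `k`. -/
def stopping (Φ : ℕ × ι → ℝ≥0∞) : Set (ℕ × ι) := ⋃ k : ℤ, G.top {c | 2 ^ k < Φ c}

/-- The part of the cell `Q` on which no cell has `Φ` larger than `2 * Φ Q`. For stopping cells
these sets carry half of the measure of the cell and overlap at most twice. -/
def core (Φ : ℕ × ι → ℝ≥0∞) (Q : ℕ × ι) : Set X :=
  G.cell Q ∩ {x | ∀ j, Φ (G.cellAt j x) ≤ 2 * Φ Q}

variable {G} {Φ : ℕ × ι → ℝ≥0∞}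

lemma pos_of_mem_stopping {Q : ℕ × ι} (hQ : Q ∈ G.stopping Φ) : Φ Q ≠ 0 := by
  obtain ⟨k, hk⟩ := Set.mem_iUnion.1 hQ
  have : (2 : ℝ≥0∞) ^ k < Φ Q := hk.1
  exact (bot_le.trans_lt this).ne'

lemma le_of_mem_stopping {Q : ℕ × ι} (hQ : Q ∈ G.stopping Φ) {x : X} (hx : x ∈ G.cell Q) {j : ℕ}
    (hj : j < Q.1) : Φ (G.cellAt j x) ≤ Φ Q := by
  obtain ⟨k, hk⟩ := Set.mem_iUnion.1 hQ
  exact (not_lt.1 (hk.2 x hx j hj)).trans (le_of_lt hk.1)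

lemma mem_top_of_le {a b : ℝ≥0∞} {Q : ℕ × ι} (hQ : Q ∈ G.top {c | a < Φ c}) (hab : a ≤ b)
    (hb : b < Φ Q) : Q ∈ G.top {c | b < Φ c} :=
  ⟨hb, fun x hx i hi h => hQ.2 x hx i hi (hab.trans_lt h)⟩

lemma zpow_two_lt_zpow_two {k l : ℤ} (h : (2 : ℝ≥0∞) ^ k < 2 ^ l) : k < l := by
  by_contra hkl
  exact absurd (ENNReal.zpow_le_of_le one_le_two (not_lt.1 hkl)) (not_le.2 h)

/-- The supremum of `Φ` over the cells that contain a point is attained, up to a factor two, by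
stopping cells. -/
lemma iSup_rpow_le_tsum_stopping (hΦ : ∀ c, Φ c ≠ ∞) {r : ℝ} (hr : 0 < r) (x : X) :
    (⨆ j, Φ (G.cellAt j x)) ^ r ≤
      2 ^ r * ∑' Q : G.stopping Φ, (G.cell Q).indicator (fun _ => Φ Q ^ r) x := by
  rw [← ENNReal.le_rpow_inv_iff hr]
  refine iSup_le fun j => ?_
  rw [ENNReal.le_rpow_inv_iff hr]
  by_cases h0 : Φ (G.cellAt j x) = 0
  · rw [h0, ENNReal.zero_rpow_of_pos hr]
    exact bot_le
  obtain ⟨k, hk1, hk2⟩ := ENNReal.exists_mem_Ioc_zpow h0 (hΦ _) ENNReal.one_lt_two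
    ENNReal.ofNat_ne_top
  obtain ⟨d, hd, hxd, -⟩ := G.exists_mem_top (A := {c | 2 ^ k < Φ c}) hk1 (G.mem_cell_cellAt j x)
  have hle : Φ (G.cellAt j x) ≤ 2 * Φ d := by
    refine hk2.trans ?_
    rw [ENNReal.zpow_add two_ne_zero ENNReal.ofNat_ne_top, zpow_one, mul_comm]
    exact mul_le_mul_right (le_of_lt hd.1) 2
  calc Φ (G.cellAt j x) ^ r ≤ (2 * Φ d) ^ r := by gcongr
    _ = 2 ^ r * Φ d ^ r := ENNReal.mul_rpow_of_nonneg _ _ hr.le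
    _ ≤ _ := by
        refine mul_le_mul_right ?_ _
        have := ENNReal.le_tsum (f := fun Q : G.stopping Φ =>
          (G.cell Q).indicator (fun _ => Φ Q ^ r) x) ⟨d, Set.mem_iUnion.2 ⟨k, hd⟩⟩
        simpa [Set.indicator_of_mem hxd] using this

lemma tsum_indicator_top_le_one (A : Set (ℕ × ι)) (x : X) :
    ∑' Q, (G.top A).indicator (fun Q => (G.cell Q).indicator (fun _ => (1 : ℝ≥0∞)) x) Q ≤ 1 := by
  by_cases h : ∃ Q ∈ G.top A, x ∈ G.cell Q
  · obtain ⟨Q, hQ, hx⟩ := h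
    rw [tsum_eq_single Q]
    · simp [hQ, hx]
    · intro Q' hne
      refine Set.indicator_apply_eq_zero.2 fun hQ' => Set.indicator_apply_eq_zero.2 fun hx' => ?_
      exact absurd (G.eq_of_mem_top hQ' hQ hx' hx) hne
  · push Not at h
    have : ∀ Q, (G.top A).indicator
        (fun Q => (G.cell Q).indicator (fun _ => (1 : ℝ≥0∞)) x) Q = 0 := fun Q =>
      Set.indicator_apply_eq_zero.2 fun hQ => Set.indicator_of_notMem (h Q hQ) _
    simp [this]

/-- The cores of the stopping cells overlap at most twice: on the core of `Q`, the value `Φ Q`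
is comparable with the supremum of `Φ` over all cells containing the point, and this leaves room
for two consecutive exponents of the powers of two. -/
lemma tsum_indicator_core_le (hΦ : ∀ c, Φ c ≠ ∞) (x : X) :
    ∑' Q : G.stopping Φ, (G.core Φ Q).indicator (fun _ => (1 : ℝ≥0∞)) x ≤ 2 := by
  by_cases h : ∃ Q ∈ G.stopping Φ, x ∈ G.core Φ Q
  swap
  · push Not at h
    have : ∀ Q : G.stopping Φ, (G.core Φ Q).indicator (fun _ => (1 : ℝ≥0∞)) x = 0 := fun Q =>
      Set.indicator_of_notMem (h Q Q.2) _
    simp [this]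
  set s := ⨆ j, Φ (G.cellAt j x) with hs
  have hle : ∀ Q, x ∈ G.core Φ Q → Φ Q ≤ s ∧ s ≤ 2 * Φ Q := fun Q hQ => by
    refine ⟨?_, iSup_le hQ.2⟩
    rw [← G.cellAt_eq hQ.1]
    exact le_iSup (fun j => Φ (G.cellAt j x)) Q.1
  obtain ⟨L, hL1, hL2⟩ : ∃ L : ℤ, s ∈ Set.Ioc ((2 : ℝ≥0∞) ^ L) (2 ^ (L + 1)) := by
    obtain ⟨Q, hQ, hx⟩ := h
    obtain ⟨h1, h2⟩ := hle Q hx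
    exact ENNReal.exists_mem_Ioc_zpow
      (fun h0 => pos_of_mem_stopping hQ (le_bot_iff.1 (h1.trans_eq h0)))
      (ne_top_of_le_ne_top (ENNReal.mul_ne_top ENNReal.ofNat_ne_top (hΦ Q)) h2)
      ENNReal.one_lt_two ENNReal.ofNat_ne_top
  have hmem : ∀ Q ∈ G.stopping Φ, x ∈ G.core Φ Q →
      Q ∈ G.top {c | 2 ^ L < Φ c} ∨ Q ∈ G.top {c | 2 ^ (L - 1) < Φ c} := by
    intro Q hQ hx
    obtain ⟨h1, h2⟩ := hle Q hx
    obtain ⟨k, hk⟩ := Set.mem_iUnion.1 hQ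
    have hkQ : (2 : ℝ≥0∞) ^ k < Φ Q := hk.1
    have hL : (2 : ℝ≥0∞) ^ L = 2 * 2 ^ (L - 1) := by
      conv_lhs => rw [← sub_add_cancel L 1]
      rw [ENNReal.zpow_add two_ne_zero ENNReal.ofNat_ne_top, zpow_one, mul_comm]
    rcases lt_or_ge ((2 : ℝ≥0∞) ^ L) (Φ Q) with hlt | hge
    · refine Or.inl (mem_top_of_le hk ?_ hlt)
      have := zpow_two_lt_zpow_two (hkQ.trans_le (h1.trans hL2))
      exact ENNReal.zpow_le_of_le one_le_two (by omega)
    · refine Or.inr (mem_top_of_le hk ?_ ?_)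
      · have := zpow_two_lt_zpow_two (hkQ.trans_le hge)
        exact ENNReal.zpow_le_of_le one_le_two (by omega)
      · by_contra hcon
        refine absurd (hL1.trans_le h2) (not_lt.2 ?_)
        rw [hL]
        exact mul_le_mul_right (not_lt.1 hcon) 2
  calc ∑' Q : G.stopping Φ, (G.core Φ Q).indicator (fun _ => (1 : ℝ≥0∞)) x
      = ∑' Q, (G.stopping Φ).indicator
          (fun Q => (G.core Φ Q).indicator (fun _ => (1 : ℝ≥0∞)) x) Q :=
        tsum_subtype (G.stopping Φ) fun Q => (G.core Φ Q).indicator (fun _ => (1 : ℝ≥0∞)) x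
    _ ≤ ∑' Q, ((G.top {c | 2 ^ L < Φ c}).indicator
            (fun Q => (G.cell Q).indicator (fun _ => (1 : ℝ≥0∞)) x) Q +
          (G.top {c | 2 ^ (L - 1) < Φ c}).indicator
            (fun Q => (G.cell Q).indicator (fun _ => (1 : ℝ≥0∞)) x) Q) := by
        refine ENNReal.tsum_le_tsum fun Q => ?_
        by_cases hQ : Q ∈ G.stopping Φ
        swap
        · simp [hQ]
        by_cases hx : x ∈ G.core Φ Q
        swap
        · rw [Set.indicator_of_mem hQ, Set.indicator_of_notMem hx]
          exact bot_le
        rw [Set.indicator_of_mem hQ, Set.indicator_of_mem hx]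
        rcases hmem Q hQ hx with h | h
        · rw [Set.indicator_of_mem h, Set.indicator_of_mem hx.1]
          exact le_self_add
        · rw [Set.indicator_of_mem h, Set.indicator_of_mem hx.1]
          exact le_add_self
    _ ≤ 2 := by
        rw [ENNReal.tsum_add, ← one_add_one_eq_two]
        exact add_le_add (tsum_indicator_top_le_one _ x) (tsum_indicator_top_le_one _ x)

variable [Countable ι]

lemma measurableSet_core (Q : ℕ × ι) : MeasurableSet (G.core Φ Q) := by
  have : G.core Φ Q = G.cell Q ∩ ⋂ j : ℕ, ⋂ v : ι, {x | Φ (j, v) ≤ 2 * Φ Q} ∪ (G.cell (j, v))ᶜ := by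
    ext x
    simp only [core, Set.mem_inter_iff, Set.mem_ofPred_eq, Set.mem_iInter, Set.mem_union,
      Set.mem_compl_iff]
    refine and_congr_right fun _ => forall_congr' fun j => ⟨fun h v => ?_, fun h => ?_⟩
    · by_cases hv : x ∈ G.cell (j, v)
      · exact Or.inl (by rw [← G.cellAt_eq hv]; exact h)
      · exact Or.inr hv
    · exact (h (G.idx j x)).resolve_right fun hn => hn rfl
  rw [this]
  refine (G.measurableSet_cell Q).inter (MeasurableSet.iInter fun j => MeasurableSet.iInter fun v =>
    (MeasurableSet.const _).union (G.measurableSet_cell _).compl)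

/-- A stopping cell has at most twice the measure of its core, provided `c ↦ μ (cell c) * Φ c`
is superadditive over disjoint cells. -/
lemma measure_cell_le_two_mul_core (μ : Measure X) (hμ : ∀ c, μ (G.cell c) ≠ ∞)
    (hΦ : ∀ c, Φ c ≠ ∞)
    (hsuper : ∀ (A : Set (ℕ × ι)) (R : ℕ × ι), (∀ c ∈ A, G.cell c ⊆ G.cell R) →
      ∑' c : G.top A, μ (G.cell c) * Φ c ≤ μ (G.cell R) * Φ R)
    {Q : ℕ × ι} (hQ : Q ∈ G.stopping Φ) : μ (G.cell Q) ≤ 2 * μ (G.core Φ Q) := by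
  set A : Set (ℕ × ι) := {c | 2 * Φ Q < Φ c ∧ G.cell c ⊆ G.cell Q} with hA
  have hQ0 := pos_of_mem_stopping hQ
  have hcover : G.cell Q ⊆ G.core Φ Q ∪ ⋃ c : G.top A, G.cell c := by
    intro x hx
    by_cases hall : ∀ j, Φ (G.cellAt j x) ≤ 2 * Φ Q
    · exact Or.inl ⟨hx, hall⟩
    · push Not at hall
      obtain ⟨j, hj⟩ := hall
      have hjQ : Q.1 ≤ j := by
        by_contra hlt
        refine absurd hj (not_lt.2 ((le_of_mem_stopping hQ hx (not_le.1 hlt)).trans ?_))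
        exact le_mul_of_one_le_left' one_le_two
      obtain ⟨d, hd, hxd, -⟩ := G.exists_mem_top (A := A)
        ⟨hj, G.cell_subset (G.mem_cell_cellAt j x) hx hjQ⟩ (G.mem_cell_cellAt j x)
      exact Or.inr (Set.mem_iUnion.2 ⟨⟨d, hd⟩, hxd⟩)
  have hsmall : 2 * μ (⋃ c : G.top A, G.cell c) ≤ μ (G.cell Q) := by
    rw [← ENNReal.mul_le_mul_iff_left hQ0 (hΦ Q)]
    refine le_trans ?_ (hsuper A Q fun c hc => hc.2)
    rw [← tsum_measure_top, mul_right_comm, ← ENNReal.tsum_mul_left]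
    refine ENNReal.tsum_le_tsum fun c => ?_
    rw [mul_comm]
    exact mul_le_mul_right c.2.1.1.le _
  have h1 : μ (G.cell Q) ≤ μ (G.core Φ Q) + μ (⋃ c : G.top A, G.cell c) :=
    (measure_mono hcover).trans (measure_union_le _ _)
  have h2 : μ (G.cell Q) + μ (G.cell Q) ≤ 2 * μ (G.core Φ Q) + μ (G.cell Q) := by
    rw [← two_mul]
    refine (mul_le_mul_right h1 2).trans ?_
    rw [mul_add]
    gcongr
  exact (ENNReal.add_le_add_iff_right (hμ Q)).1 h2

/-- The packing condition for the stopping cells with respect to another measure `σ`: the sum of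
the `σ`-measures of the stopping cells inside `R` is controlled by the integral over `R` of any
function that dominates the ratios `σ / μ` of the cells inside `R`. -/
theorem tsum_stopping_le (μ σ : Measure X) (hμ : ∀ c, μ (G.cell c) ≠ ∞)
    (hμ0 : ∀ c, μ (G.cell c) ≠ 0) (hΦ : ∀ c, Φ c ≠ ∞)
    (hsuper : ∀ (A : Set (ℕ × ι)) (R : ℕ × ι), (∀ c ∈ A, G.cell c ⊆ G.cell R) →
      ∑' c : G.top A, μ (G.cell c) * Φ c ≤ μ (G.cell R) * Φ R)
    (R : ℕ × ι) (H : X → ℝ≥0∞)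
    (hH : ∀ Q, G.cell Q ⊆ G.cell R → ∀ x ∈ G.cell Q, σ (G.cell Q) / μ (G.cell Q) ≤ H x) :
    ∑' Q : {Q | G.cell Q ⊆ G.cell R}, (G.stopping Φ).indicator (fun Q => σ (G.cell Q)) Q ≤
      4 * ∫⁻ x in G.cell R, H x ∂μ := by
  set T : Set (ℕ × ι) := {Q | G.cell Q ⊆ G.cell R} ∩ G.stopping Φ with hT
  have hcell : ∀ Q : T, σ (G.cell Q) ≤ 2 * ∫⁻ x in G.core Φ Q, H x ∂μ := by
    intro Q
    calc σ (G.cell Q) = σ (G.cell Q) / μ (G.cell Q) * μ (G.cell Q) :=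
          (ENNReal.div_mul_cancel (hμ0 _) (hμ _)).symm
      _ ≤ σ (G.cell Q) / μ (G.cell Q) * (2 * μ (G.core Φ Q)) := by
          gcongr
          exact measure_cell_le_two_mul_core μ hμ hΦ hsuper Q.2.2
      _ = 2 * ∫⁻ x in G.core Φ Q, σ (G.cell Q) / μ (G.cell Q) ∂μ := by
          rw [setLIntegral_const]
          ring
      _ ≤ _ := by
          gcongr 2 * ?_
          exact setLIntegral_mono' (measurableSet_core _) fun x hx => hH Q Q.2.1 x hx.1
  have hoverlap : Measure.sum (fun Q : T => μ.restrict (G.core Φ Q)) ≤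
      (2 : ℝ≥0∞) • μ.restrict (G.cell R) := by
    refine Measure.le_iff.2 fun s hs => ?_
    rw [Measure.sum_apply _ hs, Measure.smul_apply, smul_eq_mul, Measure.restrict_apply hs]
    calc ∑' Q : T, μ.restrict (G.core Φ Q) s
        = ∑' Q : T, ∫⁻ x in s ∩ G.cell R, (G.core Φ Q).indicator (fun _ => 1) x ∂μ := by
          refine tsum_congr fun Q => ?_
          rw [lintegral_indicator (measurableSet_core _), setLIntegral_one,
            Measure.restrict_apply (measurableSet_core _), Measure.restrict_apply hs]
          congr 1
          ext x
          have : x ∈ G.core Φ Q → x ∈ G.cell R := fun hx => Q.2.1 hx.1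
          simp only [Set.mem_inter_iff]
          tauto
      _ = ∫⁻ x in s ∩ G.cell R, ∑' Q : T, (G.core Φ Q).indicator (fun _ => 1) x ∂μ :=
          (lintegral_tsum fun Q =>
            (measurable_const.indicator (measurableSet_core _)).aemeasurable).symm
      _ ≤ ∫⁻ x in s ∩ G.cell R, 2 ∂μ := lintegral_mono fun x =>
          (ENNReal.tsum_mono_subtype (fun Q => (G.core Φ Q).indicator (fun _ => (1 : ℝ≥0∞)) x)
            (Set.inter_subset_right : T ⊆ G.stopping Φ)).trans (tsum_indicator_core_le hΦ x)
      _ = 2 * μ (s ∩ G.cell R) := setLIntegral_const _ _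
  calc ∑' Q : {Q | G.cell Q ⊆ G.cell R}, (G.stopping Φ).indicator (fun Q => σ (G.cell Q)) Q
      = ∑' Q : T, σ (G.cell Q) := by
        rw [tsum_subtype {Q | G.cell Q ⊆ G.cell R}
          ((G.stopping Φ).indicator (fun Q => σ (G.cell Q))), Set.indicator_indicator,
          tsum_subtype T (fun Q => σ (G.cell Q))]
    _ ≤ ∑' Q : T, 2 * ∫⁻ x in G.core Φ Q, H x ∂μ := ENNReal.tsum_le_tsum hcell
    _ = 2 * ∫⁻ x, H x ∂(Measure.sum fun Q : T => μ.restrict (G.core Φ Q)) := by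
        rw [ENNReal.tsum_mul_left, lintegral_sum_measure]
    _ ≤ 2 * ∫⁻ x, H x ∂((2 : ℝ≥0∞) • μ.restrict (G.cell R)) := by
        gcongr
    _ = 4 * ∫⁻ x in G.cell R, H x ∂μ := by
        rw [lintegral_smul_measure, smul_eq_mul, ← mul_assoc]
        norm_num

end NestedGrid

lemma ennreal_rpow_sum {κ : Type*} {x : ℝ≥0∞} (h0 : x ≠ 0) (h : x ≠ ∞) (s : Finset κ)
    (f : κ → ℝ) : x ^ (∑ i ∈ s, f i) = ∏ i ∈ s, x ^ f i := by
  classical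
  induction s using Finset.induction_on with
  | empty => simp
  | insert i s hi ih =>
    rw [Finset.sum_insert hi, Finset.prod_insert hi, ENNReal.rpow_add _ _ h0 h, ih]

namespace NestedGrid

variable {X ι : Type*} [MeasurableSpace X] (G : NestedGrid X ι)

/-! ### The weighted estimate on a single grid -/

/-- The normalized product of integrals `(∏ᵢ ∫_Q hᵢ dσᵢ) ^ (1 / γ) / μ Q`. Its power with
exponent `γ` is the quantity of which the fractional maximal function is the supremum, and its
multiple by `μ Q` is superadditive over disjoint cells. -/
def normalizedProd {m : ℕ} (μ : Measure X) (σ : Fin m → Measure X) (h : Fin m → X → ℝ≥0∞) (γ : ℝ)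
    (c : ℕ × ι) : ℝ≥0∞ :=
  (∏ i, ∫⁻ x in G.cell c, h i x ∂(σ i)) ^ (1 / γ) / μ (G.cell c)

variable {G} {m : ℕ} {μ : Measure X} {σ : Fin m → Measure X} {h : Fin m → X → ℝ≥0∞} {γ : ℝ}

lemma normalizedProd_rpow (hγ : 0 < γ) (c : ℕ × ι) {q : ℝ} (hq : 0 ≤ q) :
    G.normalizedProd μ σ h γ c ^ (q * γ) =
      (∏ i, (∫⁻ x in G.cell c, h i x ∂(σ i)) ^ q) / μ (G.cell c) ^ (q * γ) := by
  rw [normalizedProd, ENNReal.div_rpow_of_nonneg _ _ (by positivity), ← ENNReal.rpow_mul,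
    ENNReal.prod_rpow_of_nonneg hq]
  congr 2
  field_simp

/-- The weight condition turns `Φ ^ (q γ) ν` on a cell into a product of powers of the means of
the `hᵢ` with respect to the `σᵢ`. -/
lemma normalizedProd_rpow_mul_le (ν : Measure X) (P : Fin m → ℝ) {q : ℝ} {W : ℝ≥0∞}
    (hP : ∀ i, 1 < P i) (hq : 0 < q) (hγ : 0 < γ)
    (hexp : q * γ = 1 + ∑ i, q / (P i).conjExponent) {c : ℕ × ι} (hμ : μ (G.cell c) ≠ ∞)
    (hμ0 : μ (G.cell c) ≠ 0) (hσ : ∀ i, σ i (G.cell c) ≠ ∞) (hσ0 : ∀ i, σ i (G.cell c) ≠ 0)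
    (hW : ν (G.cell c) / μ (G.cell c) *
      ∏ i, (σ i (G.cell c) / μ (G.cell c)) ^ (q / (P i).conjExponent) ≤ W) :
    G.normalizedProd μ σ h γ c ^ (q * γ) * ν (G.cell c) ≤
      W * ∏ i, (σ i (G.cell c) *
        ((∫⁻ x in G.cell c, h i x ∂(σ i)) / σ i (G.cell c)) ^ P i) ^ (q / P i) := by
  have hconj : ∀ i, q = q / (P i).conjExponent + q / P i := fun i => by
    have := hP i
    have h1 : P i ≠ 0 := by linarith
    have h2 : P i - 1 ≠ 0 := by linarith
    rw [Real.conjExponent]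
    field_simp
    ring
  have hc0 : ∀ i, 0 < q / (P i).conjExponent := fun i => by
    have := hP i
    have h2 : 0 < P i - 1 := by linarith
    rw [Real.conjExponent]
    positivity
  set M := μ (G.cell c) with hM
  have e1 : ∀ i, (∫⁻ x in G.cell c, h i x ∂(σ i)) ^ q =
      σ i (G.cell c) ^ (q / (P i).conjExponent) * (σ i (G.cell c) *
        ((∫⁻ x in G.cell c, h i x ∂(σ i)) / σ i (G.cell c)) ^ P i) ^ (q / P i) := fun i => by
    have hPi : 0 < P i := by linarith [hP i]
    conv_lhs => rw [← ENNReal.div_mul_cancel (hσ0 i) (hσ i)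
      (b := ∫⁻ x in G.cell c, h i x ∂(σ i)), ENNReal.mul_rpow_of_nonneg _ _ hq.le]
    rw [ENNReal.mul_rpow_of_nonneg _ _ (by positivity), ← ENNReal.rpow_mul,
      mul_div_cancel₀ _ hPi.ne', ← mul_assoc, ← ENNReal.rpow_add _ _ (hσ0 i) (hσ i), ← hconj i,
      mul_comm]
  have e2 : M ^ (q * γ) = M * ∏ i, M ^ (q / (P i).conjExponent) := by
    rw [hexp, ENNReal.rpow_add _ _ hμ0 hμ, ENNReal.rpow_one]
    congr 1
    exact ennreal_rpow_sum hμ0 hμ _ _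
  have e3 : ∀ i, (σ i (G.cell c) / M) ^ (q / (P i).conjExponent) =
      σ i (G.cell c) ^ (q / (P i).conjExponent) * (M ^ (q / (P i).conjExponent))⁻¹ := fun i => by
    rw [ENNReal.div_rpow_of_nonneg _ _ (hc0 i).le, div_eq_mul_inv]
  have hpow0 : ∀ i, M ^ (q / (P i).conjExponent) ≠ 0 := fun i =>
    (ENNReal.rpow_pos (pos_iff_ne_zero.2 hμ0) hμ).ne'
  have hpow : ∀ i, M ^ (q / (P i).conjExponent) ≠ ∞ := fun i =>
    ENNReal.rpow_ne_top_of_nonneg (hc0 i).le hμ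
  rw [normalizedProd_rpow hγ c hq.le, e2, div_eq_mul_inv, ENNReal.mul_inv (Or.inl hμ0) (Or.inl hμ),
    ENNReal.prod_inv_distrib (by
      intro i _ j _ _
      exact Or.inl (hpow0 i))]
  refine le_trans (le_of_eq ?_) (mul_le_mul_left hW _)
  simp only [e1, e3, Finset.prod_mul_distrib]
  rw [div_eq_mul_inv]
  ring

variable [Countable ι]

lemma tsum_normalizedProd_le (hμ : ∀ c, μ (G.cell c) ≠ ∞) (hμ0 : ∀ c, μ (G.cell c) ≠ 0)
    (hγ : 0 < γ) (hγm : γ ≤ m) (A : Set (ℕ × ι)) (R : ℕ × ι)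
    (hAR : ∀ c ∈ A, G.cell c ⊆ G.cell R) :
    ∑' c : G.top A, μ (G.cell c) * G.normalizedProd μ σ h γ c ≤
      μ (G.cell R) * G.normalizedProd μ σ h γ R := by
  have e : ∀ c, μ (G.cell c) * G.normalizedProd μ σ h γ c =
      ∏ i, (∫⁻ x in G.cell c, h i x ∂(σ i)) ^ (1 / γ) := fun c => by
    rw [normalizedProd, ENNReal.mul_div_cancel (hμ0 c) (hμ c),
      ENNReal.prod_rpow_of_nonneg (by positivity)]
  simp only [e]
  refine (tsum_prod_rpow_le (fun i (c : G.top A) => ∫⁻ x in G.cell c, h i x ∂(σ i))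
    (fun _ => 1 / γ) (fun _ => by positivity) ?_).trans ?_
  · rw [Finset.sum_const, Finset.card_univ, Fintype.card_fin, nsmul_eq_mul, mul_one_div,
      le_div_iff₀ hγ, one_mul]
    exact hγm
  · refine Finset.prod_le_prod' fun i _ => ENNReal.rpow_le_rpow ?_ (by positivity)
    rw [tsum_lintegral_top]
    exact lintegral_mono_set (Set.iUnion_subset fun c => hAR c c.2.1)

/-- The weighted norm inequality on a single grid, with abstract measures: `ν` is the target
measure, the `σᵢ` are the dual measures, `W` is the constant of the joint weight condition and
`Λᵢ` plays the role of the `A_∞` constant of `σᵢ`. -/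
theorem lintegral_iSup_normalizedProd_le (ν : Measure X) [∀ i, SFinite (σ i)]
    (hh : ∀ i, Measurable (h i)) (P : Fin m → ℝ) {q : ℝ} {W : ℝ≥0∞} (Λ : Fin m → ℝ≥0∞)
    (hP : ∀ i, 1 < P i) (hq : 0 < q) (hPq : 1 ≤ ∑ i, q / P i) (hγ : 0 < γ) (hγm : γ ≤ m)
    (hexp : q * γ = 1 + ∑ i, q / (P i).conjExponent) (hμ : ∀ c, μ (G.cell c) ≠ ∞)
    (hμ0 : ∀ c, μ (G.cell c) ≠ 0) (hσ : ∀ i c, σ i (G.cell c) ≠ ∞)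
    (hσ0 : ∀ i c, σ i (G.cell c) ≠ 0)
    (hh1 : ∀ i c, ∫⁻ x in G.cell c, h i x ∂(σ i) ≠ ∞)
    (hW : ∀ c, ν (G.cell c) / μ (G.cell c) *
      ∏ i, (σ i (G.cell c) / μ (G.cell c)) ^ (q / (P i).conjExponent) ≤ W)
    (hΛ : ∀ i R, ∃ H : X → ℝ≥0∞, (∀ Q, G.cell Q ⊆ G.cell R → ∀ x ∈ G.cell Q,
      σ i (G.cell Q) / μ (G.cell Q) ≤ H x) ∧ ∫⁻ x in G.cell R, H x ∂μ ≤ Λ i * σ i (G.cell R)) :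
    ∫⁻ x, (⨆ j, G.normalizedProd μ σ h γ (G.cellAt j x)) ^ (q * γ) ∂ν ≤
      2 ^ (q * γ) * (W * ∏ i, (ENNReal.ofReal (P i * 2 ^ P i / (P i - 1)) * (4 * Λ i) *
        ∫⁻ x, h i x ^ P i ∂(σ i)) ^ (q / P i)) := by
  set Φ := G.normalizedProd μ σ h γ with hΦdef
  have hΦ : ∀ c, Φ c ≠ ∞ := fun c => by
    refine ENNReal.div_ne_top (ENNReal.rpow_ne_top_of_nonneg (by positivity) ?_) (hμ0 c)
    exact ENNReal.prod_ne_top fun i _ => hh1 i c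
  have hPpos : ∀ i, 0 < P i := fun i => by linarith [hP i]
  set a : Fin m → ℕ × ι → ℝ≥0∞ := fun i Q =>
    ((∫⁻ x in G.cell Q, h i x ∂(σ i)) / σ i (G.cell Q)) ^ P i with ha
  have carleson : ∀ i, ∑' Q : G.stopping Φ, σ i (G.cell Q) * a i Q ≤
      ENNReal.ofReal (P i * 2 ^ P i / (P i - 1)) * (4 * Λ i) * ∫⁻ x, h i x ^ P i ∂(σ i) := by
    intro i
    refine le_trans (le_of_eq ?_) (G.carleson_embedding (σ i) (hh i) (hσ i)
      ((G.stopping Φ).indicator fun Q => σ i (G.cell Q)) (4 * Λ i) ?_ (hP i))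
    · rw [tsum_subtype (G.stopping Φ) (fun Q => σ i (G.cell Q) * a i Q)]
      refine tsum_congr fun Q => ?_
      by_cases hQ : Q ∈ G.stopping Φ
      · rw [Set.indicator_of_mem hQ, Set.indicator_of_mem hQ]
      · rw [Set.indicator_of_notMem hQ, Set.indicator_of_notMem hQ, zero_mul]
    · intro R
      obtain ⟨H, hH, hHR⟩ := hΛ i R
      refine (tsum_stopping_le μ (σ i) hμ hμ0 hΦ (fun A R hAR =>
        tsum_normalizedProd_le hμ hμ0 hγ hγm A R hAR) R H hH).trans ?_
      rw [mul_assoc]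
      gcongr
  calc ∫⁻ x, (⨆ j, Φ (G.cellAt j x)) ^ (q * γ) ∂ν
      ≤ ∫⁻ x, 2 ^ (q * γ) * ∑' Q : G.stopping Φ,
          (G.cell Q).indicator (fun _ => Φ Q ^ (q * γ)) x ∂ν :=
        lintegral_mono fun x => iSup_rpow_le_tsum_stopping hΦ (by positivity) x
    _ = 2 ^ (q * γ) * ∑' Q : G.stopping Φ, Φ Q ^ (q * γ) * ν (G.cell Q) := by
        have hmeas : ∀ Q : G.stopping Φ, Measurable
            ((G.cell Q).indicator (fun _ : X => Φ Q ^ (q * γ))) := fun Q =>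
          measurable_const.indicator (G.measurableSet_cell Q)
        rw [lintegral_const_mul _ (Measurable.tsum hmeas),
          lintegral_tsum fun Q => (hmeas Q).aemeasurable]
        congr 1
        refine tsum_congr fun Q => ?_
        rw [lintegral_indicator (G.measurableSet_cell Q), setLIntegral_const]
    _ ≤ 2 ^ (q * γ) * ∑' Q : G.stopping Φ, W * ∏ i, (σ i (G.cell Q) * a i Q) ^ (q / P i) := by
        refine mul_le_mul_right (ENNReal.tsum_le_tsum fun Q => ?_) _
        exact normalizedProd_rpow_mul_le ν P hP hq hγ hexp (hμ Q) (hμ0 Q) (fun i => hσ i Q)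
          (fun i => hσ0 i Q) (hW Q)
    _ ≤ _ := by
        rw [ENNReal.tsum_mul_left]
        refine mul_le_mul_right (mul_le_mul_right ?_ _) _
        refine (tsum_prod_rpow_le (fun i (Q : G.stopping Φ) => σ i (G.cell Q) * a i Q)
          (fun i => q / P i) (fun i => (div_pos hq (hPpos i)).le) hPq).trans ?_
        exact Finset.prod_le_prod' fun i _ =>
          ENNReal.rpow_le_rpow (carleson i) (div_pos hq (hPpos i)).le

end NestedGrid

/-! ### Shifted dyadic grids -/

/-- The closed cube with lower corner `a` and side `l`. -/
def closedCube {n : ℕ} (a : E n) (l : ℝ) : Set (E n) := {y | ∀ j, a j ≤ y j ∧ y j ≤ a j + l}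

/-- The half-open cube with lower corner `a` and side `l`. -/
def halfOpenCube {n : ℕ} (a : E n) (l : ℝ) : Set (E n) := {y | ∀ j, a j ≤ y j ∧ y j < a j + l}

lemma isCube_closedCube {n : ℕ} (a : E n) {l : ℝ} (hl : 0 < l) : IsCube (closedCube a l) :=
  ⟨a, l, hl, rfl⟩

lemma closedCube_eq_preimage {n : ℕ} (a : E n) (l : ℝ) :
    closedCube a l = WithLp.ofLp ⁻¹' (Set.Icc (fun j => a j) (fun j => a j + l)) := by
  ext y
  simp [closedCube, Pi.le_def, forall_and]

lemma halfOpenCube_eq_preimage {n : ℕ} (a : E n) (l : ℝ) :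
    halfOpenCube a l = WithLp.ofLp ⁻¹' (Set.univ.pi fun j => Set.Ico (a j) (a j + l)) := by
  ext y
  simp [halfOpenCube]

lemma measurableSet_closedCube {n : ℕ} (a : E n) (l : ℝ) : MeasurableSet (closedCube a l) := by
  rw [closedCube_eq_preimage]
  exact (PiLp.volume_preserving_ofLp (Fin n)).measurable measurableSet_Icc

lemma IsCube.measurableSet {n : ℕ} {Q : Set (E n)} (hQ : IsCube Q) : MeasurableSet Q := by
  obtain ⟨a, l, -, rfl⟩ := hQ
  exact measurableSet_closedCube a l

lemma volume_closedCube {n : ℕ} (a : E n) (l : ℝ) :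
    volume (closedCube a l) = ENNReal.ofReal l ^ n := by
  rw [closedCube_eq_preimage, (PiLp.volume_preserving_ofLp (Fin n)).measure_preimage
    measurableSet_Icc.nullMeasurableSet, Real.volume_Icc_pi]
  simp

lemma halfOpenCube_ae_eq {n : ℕ} (a : E n) (l : ℝ) :
    halfOpenCube a l =ᵐ[volume] closedCube a l := by
  rw [closedCube_eq_preimage, halfOpenCube_eq_preimage]
  exact (PiLp.volume_preserving_ofLp (Fin n)).quasiMeasurePreserving.preimage_ae_eq
    Measure.univ_pi_Ico_ae_eq_Icc

lemma IsCube.volume_ne_top {n : ℕ} {Q : Set (E n)} (hQ : IsCube Q) : volume Q ≠ ∞ := by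
  obtain ⟨a, l, -, rfl⟩ := hQ
  change volume (closedCube a l) ≠ ∞
  rw [volume_closedCube]
  exact ENNReal.pow_ne_top ENNReal.ofReal_ne_top

lemma IsCube.volume_ne_zero {n : ℕ} {Q : Set (E n)} (hQ : IsCube Q) : volume Q ≠ 0 := by
  obtain ⟨a, l, hl, rfl⟩ := hQ
  change volume (closedCube a l) ≠ 0
  rw [volume_closedCube]
  exact pow_ne_zero _ (by simpa using hl)

/-- Any cube is contained in arbitrarily large cubes centred at the origin. -/
lemma IsCube.exists_subset {n : ℕ} {Q : Set (E n)} (hQ : IsCube Q) :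
    ∃ N : ℕ, ∀ M : ℕ, N ≤ M → Q ⊆ closedCube (WithLp.toLp 2 fun _ => -(M : ℝ)) (2 * M) := by
  obtain ⟨a, l, hl, rfl⟩ := hQ
  obtain ⟨N, hN⟩ := exists_nat_ge (l + ∑ j, |a j|)
  refine ⟨N, fun M hM y hy j => ?_⟩
  have h1 : |a j| ≤ ∑ j, |a j| :=
    Finset.single_le_sum (f := fun j => |a j|) (fun _ _ => abs_nonneg _) (Finset.mem_univ j)
  have h2 := abs_le.1 (le_refl |a j|)
  have h3 : (N : ℝ) ≤ M := by exact_mod_cast hM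
  have h4 := hy j
  simp only
  constructor <;> linarith

lemma iUnion_closedCube (n : ℕ) :
    ⋃ M : ℕ, closedCube (WithLp.toLp 2 fun _ : Fin n => -((M + 1 : ℕ) : ℝ)) (2 * (M + 1 : ℕ)) =
      Set.univ := by
  refine Set.eq_univ_of_forall fun x => ?_
  obtain ⟨N, hN⟩ := IsCube.exists_subset (isCube_closedCube x one_pos)
  exact Set.mem_iUnion.2 ⟨N, hN (N + 1) (by omega) fun j => by simp⟩

lemma ae_of_forall_isCube {n : ℕ} {p : E n → Prop}
    (h : ∀ Q : Set (E n), IsCube Q → ∀ᵐ x ∂(volume.restrict Q), p x) : ∀ᵐ x : E n, p x := by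
  rw [← Measure.restrict_univ (μ := volume), ← iUnion_closedCube n, ae_restrict_iUnion_iff]
  exact fun M => h _ (isCube_closedCube _ (by positivity))

/-- The side length `4 ^ (K - j)` of the cells of level `j` in a grid with top scale `4 ^ K`. -/
def side (K j : ℕ) : ℝ := 4 ^ ((K : ℤ) - j)

/-- The offset of a grid in one coordinate, in units of the side length. As `4 / 3 - 1 / 3` is an
integer, both offsets are compatible with the subdivision of intervals into four equal parts. -/
def offset (b : Bool) : ℝ := if b then 1 / 3 else 0

lemma side_pos (K j : ℕ) : 0 < side K j := by
  unfold side
  positivity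

lemma side_succ (K j : ℕ) : side K j = 4 * side K (j + 1) := by
  unfold side
  rw [← zpow_one_add₀ (by norm_num)]
  congr 1
  push_cast
  ring

lemma floor_eq_of_floor_four_mul_eq {y z : ℝ} (h : ⌊4 * y⌋ = ⌊4 * z⌋) : ⌊y⌋ = ⌊z⌋ := by
  have key : ∀ u v : ℝ, ⌊4 * u⌋ = ⌊4 * v⌋ → ⌊u⌋ ≤ ⌊v⌋ := fun u v huv => by
    have h1 : 4 * ⌊u⌋ ≤ ⌊4 * u⌋ := Int.le_floor.2 (by push_cast; linarith [Int.floor_le u])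
    have h2 : ⌊4 * v⌋ < 4 * (⌊v⌋ + 1) :=
      Int.floor_lt.2 (by push_cast; linarith [Int.lt_floor_add_one v])
    omega
  exact le_antisymm (key y z h) (key z y h.symm)

lemma floor_div_sub_offset_eq (b : Bool) {x y l : ℝ}
    (h : ⌊x / l - offset b⌋ = ⌊y / l - offset b⌋) :
    ⌊x / (4 * l) - offset b⌋ = ⌊y / (4 * l) - offset b⌋ := by
  have e : ∀ z : ℝ, ⌊4 * (z / (4 * l) - offset b)⌋ = ⌊z / l - offset b⌋ - (if b then 1 else 0) := by
    intro z
    rw [← Int.floor_sub_intCast]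
    congr 1
    rw [mul_sub, ← mul_div_assoc, mul_div_mul_left _ _ four_ne_zero]
    cases b
    · simp [offset]
    · norm_num [offset]
      ring
  exact floor_eq_of_floor_four_mul_eq (by rw [e, e, h])

/-- The grid in `ℝⁿ` with top scale `4 ^ K`, subdivision ratio `4` and offset given by `t`. -/
def dyadicGrid {n : ℕ} (t : Fin n → Bool) (K : ℕ) : NestedGrid (E n) (Fin n → ℤ) where
  idx j x := fun i => ⌊x i / side K j - offset (t i)⌋
  measurableSet_fiber j v := by
    have : Measurable fun x : E n => fun i => ⌊x i / side K j - offset (t i)⌋ := by fun_prop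
    exact this (measurableSet_singleton v)
  idx_eq_of_succ j x y h := by
    funext i
    rw [side_succ]
    exact floor_div_sub_offset_eq _ (congrFun h i)

/-- The lower corner of a cell of `dyadicGrid t K`. -/
def corner {n : ℕ} (t : Fin n → Bool) (K : ℕ) (c : ℕ × (Fin n → ℤ)) : E n :=
  WithLp.toLp 2 fun i => side K c.1 * (c.2 i + offset (t i))

lemma cell_dyadicGrid {n : ℕ} (t : Fin n → Bool) (K : ℕ) (c : ℕ × (Fin n → ℤ)) :
    (dyadicGrid t K).cell c = halfOpenCube (corner t K c) (side K c.1) := by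
  ext x
  have hs := side_pos K c.1
  refine (funext_iff (f := (dyadicGrid t K).idx c.1 x)).trans (forall_congr' fun i => ?_)
  change ⌊x i / side K c.1 - offset (t i)⌋ = c.2 i ↔ side K c.1 * (c.2 i + offset (t i)) ≤ x i ∧
    x i < side K c.1 * (c.2 i + offset (t i)) + side K c.1
  rw [Int.floor_eq_iff, le_sub_iff_add_le, sub_lt_iff_lt_add, le_div_iff₀ hs, div_lt_iff₀ hs]
  refine and_congr (by rw [mul_comm]) ?_
  rw [show (c.2 i + 1 + offset (t i)) * side K c.1 =
    side K c.1 * (c.2 i + offset (t i)) + side K c.1 by ring]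

lemma cell_ae_eq {n : ℕ} (t : Fin n → Bool) (K : ℕ) (c : ℕ × (Fin n → ℤ)) :
    (dyadicGrid t K).cell c =ᵐ[volume] closedCube (corner t K c) (side K c.1) := by
  rw [cell_dyadicGrid]
  exact halfOpenCube_ae_eq _ _

lemma cell_subset_closedCube {n : ℕ} (t : Fin n → Bool) (K : ℕ) (c : ℕ × (Fin n → ℤ)) :
    (dyadicGrid t K).cell c ⊆ closedCube (corner t K c) (side K c.1) := by
  rw [cell_dyadicGrid]
  exact fun y hy j => ⟨(hy j).1, (hy j).2.le⟩

lemma volume_cell {n : ℕ} (t : Fin n → Bool) (K : ℕ) (c : ℕ × (Fin n → ℤ)) :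
    volume ((dyadicGrid t K).cell c) = ENNReal.ofReal (side K c.1) ^ n := by
  rw [measure_congr (cell_ae_eq t K c), volume_closedCube]

/-- The one-third trick in one dimension: an interval of length at most a third of the side length
is not cut by one of the two grids. -/
lemma exists_offset {a l L : ℝ} (hL : 0 < L) (hl : 3 * l ≤ L) :
    ∃ b : Bool, ∀ u, a ≤ u → u ≤ a + l → ⌊u / L - offset b⌋ = ⌊a / L - offset b⌋ := by
  have hlL : l / L ≤ 1 / 3 := by
    rw [div_le_iff₀ hL]
    linarith
  have key : ∀ u, a ≤ u → u ≤ a + l → a / L ≤ u / L ∧ u / L ≤ a / L + 1 / 3 := fun u h1 h2 => by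
    refine ⟨by gcongr, ?_⟩
    calc u / L ≤ (a + l) / L := by gcongr
      _ ≤ a / L + 1 / 3 := by rw [add_div]; linarith
  have h1 := Int.floor_le (a / L)
  have h2 := Int.lt_floor_add_one (a / L)
  rcases lt_or_ge (a / L) (⌊a / L⌋ + 2 / 3) with h | h
  · refine ⟨false, fun u hu1 hu2 => ?_⟩
    obtain ⟨h3, h4⟩ := key u hu1 hu2
    simp only [offset, Bool.false_eq_true, if_false, sub_zero]
    rw [Int.floor_eq_iff]
    constructor <;> linarith
  · refine ⟨true, fun u hu1 hu2 => ?_⟩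
    obtain ⟨h3, h4⟩ := key u hu1 hu2
    simp only [offset, if_true]
    have e1 : ⌊a / L - 1 / 3⌋ = ⌊a / L⌋ := by
      rw [Int.floor_eq_iff]
      constructor <;> linarith
    rw [e1, Int.floor_eq_iff]
    constructor <;> linarith

/-- The one-third trick: any cube is contained in a cell of comparable volume of one of the `2ⁿ`
shifted grids. -/
lemma IsCube.exists_cell {n : ℕ} {Q : Set (E n)} (hQ : IsCube Q) :
    ∃ (t : Fin n → Bool) (K j : ℕ),
      (∀ x ∈ Q, Q ⊆ (dyadicGrid t K).cell ((dyadicGrid t K).cellAt j x)) ∧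
      ENNReal.ofReal (side K j) ^ n ≤ 12 ^ n * volume Q := by
  obtain ⟨a, l, hl, rfl⟩ := hQ
  -- The side length `4 ^ (k + 1)` lies in `[3 l, 12 l)`.
  obtain ⟨k, hk1, hk2⟩ := exists_mem_Ioc_zpow (show (0 : ℝ) < 3 * l by linarith)
    (show (1 : ℝ) < 4 by norm_num)
  set K := (k + 1).toNat with hK
  set j := ((K : ℤ) - (k + 1)).toNat with hj
  have hside : side K j = 4 ^ (k + 1) := by
    unfold side
    congr 1
    omega
  have hchoice := fun i : Fin n => exists_offset (a := a i) (l := l) (side_pos K j)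
    (by rw [hside]; exact hk2)
  choose t ht using hchoice
  refine ⟨t, K, j, fun x hx y hy => funext fun i => ?_, ?_⟩
  · exact (ht i (y i) (hy i).1 (hy i).2).trans (ht i (x i) (hx i).1 (hx i).2).symm
  · change _ ≤ 12 ^ n * volume (closedCube a l)
    rw [volume_closedCube, ← mul_pow]
    refine pow_le_pow_left₀ (by simp) ?_ n
    rw [← ENNReal.ofReal_ofNat 12, ← ENNReal.ofReal_mul (by norm_num)]
    refine ENNReal.ofReal_le_ofReal ?_
    rw [hside, zpow_add_one₀ (by norm_num)]
    norm_num at hk1 ⊢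
    linarith

lemma cellAt_succ {n : ℕ} (t : Fin n → Bool) (K j : ℕ) (x : E n) :
    (dyadicGrid t (K + 1)).cell ((dyadicGrid t (K + 1)).cellAt (j + 1) x) =
      (dyadicGrid t K).cell ((dyadicGrid t K).cellAt j x) := by
  have hs : side (K + 1) (j + 1) = side K j := by
    unfold side
    congr 1
    push_cast
    ring
  ext y
  change (fun i => ⌊y i / side (K + 1) (j + 1) - offset (t i)⌋) =
      (fun i => ⌊x i / side (K + 1) (j + 1) - offset (t i)⌋) ↔
    (fun i => ⌊y i / side K j - offset (t i)⌋) = (fun i => ⌊x i / side K j - offset (t i)⌋)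
  rw [hs]

/-! ### The weighted estimate for the fractional maximal function -/

/-- The multilinear fractional maximal function, with `γ = m - α / n` the power of the volume in
the normalization. -/
def fractionalMaximal {m n : ℕ} (γ : ℝ) (g : Fin m → E n → ℝ≥0∞) (x : E n) : ℝ≥0∞ :=
  ⨆ (Q : Set (E n)) (_ : IsCube Q) (_ : x ∈ Q), (∏ i, ∫⁻ y in Q, g i y) / volume Q ^ γ

variable {m n : ℕ}

lemma dual_weight_ne_zero {w : ℝ≥0∞} (hw : w ≠ ∞) (r : ℝ) (hr : 0 < r) : w ^ (-r) ≠ 0 := by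
  rw [ENNReal.rpow_neg]
  exact ENNReal.inv_ne_zero.2 (ENNReal.rpow_ne_top_of_nonneg hr.le hw)

lemma conjExponent_pos {r : ℝ} (hr : 1 < r) : 0 < r.conjExponent := by
  have : 0 < r - 1 := by linarith
  rw [Real.conjExponent]
  positivity

lemma setLIntegral_ne_zero {Q : Set (E n)} (hQ : volume Q ≠ 0)
    {f : E n → ℝ≥0∞} (hf : AEMeasurable f volume) (hpos : ∀ x, f x ≠ 0) :
    ∫⁻ x in Q, f x ≠ 0 := fun h => by
  rw [lintegral_eq_zero_iff' hf.restrict] at h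
  have h2 : ∀ᵐ x ∂(volume.restrict Q), False := h.mono fun x hx => hpos x hx
  rw [Filter.eventually_false_iff_eq_bot, ae_eq_bot, Measure.restrict_eq_zero] at h2
  exact hQ h2

lemma avg_dual_weight_rpow_ne_zero {w : E n → ℝ≥0∞} {p q : ℝ} (hp : 1 < p) (hq : 0 < q)
    (hw : AEMeasurable w volume) (hw' : ∀ x, w x ≠ ∞) {Q : Set (E n)} (hQ : IsCube Q) :
    avg Q (fun x => w x ^ (-p.conjExponent)) ^ (q / p.conjExponent) ≠ 0 := by
  refine (ENNReal.rpow_pos_of_nonneg ?_ (div_pos hq (conjExponent_pos hp)).le).ne'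
  refine ENNReal.div_pos (setLIntegral_ne_zero hQ.volume_ne_zero (hw.pow_const _) fun x => ?_)
    hQ.volume_ne_top
  exact dual_weight_ne_zero (hw' x) _ (conjExponent_pos hp)

lemma le_APqConst (P : Fin m → ℝ) (q : ℝ) (w : Fin m → E n → ℝ≥0∞) {Q : Set (E n)}
    (hQ : IsCube Q) :
    avg Q (fun x => (∏ i, w i x) ^ q) *
      ∏ i, avg Q (fun x => w i x ^ (-(P i).conjExponent)) ^ (q / (P i).conjExponent) ≤
      APqConst P q w :=
  le_iSup₂ (f := fun (Q : Set (E n)) (_ : IsCube Q) => avg Q (fun x => (∏ i, w i x) ^ q) *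
    ∏ i, avg Q (fun x => w i x ^ (-(P i).conjExponent)) ^ (q / (P i).conjExponent)) Q hQ

lemma le_AInftyConst (σ : E n → ℝ≥0∞) {Q : Set (E n)} (hQ : IsCube Q) :
    (∫⁻ x in Q, hardyLittlewood (Q.indicator σ) x) / ∫⁻ x in Q, σ x ≤ AInftyConst σ :=
  le_iSup₂ (f := fun (Q : Set (E n)) (_ : IsCube Q) =>
    (∫⁻ x in Q, hardyLittlewood (Q.indicator σ) x) / ∫⁻ x in Q, σ x) Q hQ

lemma avg_le_hardyLittlewood (f : E n → ℝ≥0∞) {Q : Set (E n)} (hQ : IsCube Q) {x : E n}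
    (hx : x ∈ Q) : avg Q f ≤ hardyLittlewood f x :=
  le_iSup₂_of_le (f := fun (Q : Set (E n)) (_ : IsCube Q) => ⨆ (_ : x ∈ Q), avg Q f) Q hQ
    (le_iSup_of_le hx le_rfl)

lemma aemeasurable_prod_weight {q : ℝ} {w : Fin m → E n → ℝ≥0∞}
    (hw : ∀ i, AEMeasurable (w i) volume) :
    AEMeasurable (fun x => (∏ i, w i x) ^ q) volume :=
  (Finset.aemeasurable_fun_prod _ fun i _ => hw i).pow_const q

lemma ae_eq_zero_of_avg_eq_zero {f : E n → ℝ≥0∞} (hf : AEMeasurable f volume) {Q : Set (E n)}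
    (hQ : IsCube Q) (h : avg Q f = 0) : ∀ᵐ x ∂(volume.restrict Q), f x = 0 := by
  rw [avg, ENNReal.div_eq_zero_iff] at h
  have h1 := h.resolve_right hQ.volume_ne_top
  rwa [lintegral_eq_zero_iff' hf.restrict] at h1

/-- If one of the dual weights is not locally integrable, then the membership in the weight class
forces the product weight to vanish almost everywhere. -/
lemma ae_prod_weight_eq_zero {P : Fin m → ℝ} {q : ℝ} {w : Fin m → E n → ℝ≥0∞}
    (hP : ∀ i, 1 < P i) (hq : 0 < q) (hw : ∀ i, AEMeasurable (w i) volume)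
    (hw' : ∀ i x, w i x ≠ ∞) (hA : MemAPq P q w) {i₀ : Fin m} {Q₀ : Set (E n)} (hQ₀ : IsCube Q₀)
    (hinf : ∫⁻ x in Q₀, w i₀ x ^ (-(P i₀).conjExponent) = ∞) :
    ∀ᵐ x, (∏ i, w i x) ^ q = 0 := by
  obtain ⟨N₀, hN₀⟩ := hQ₀.exists_subset
  refine ae_of_forall_isCube fun Q₁ hQ₁ => ?_
  obtain ⟨N₁, hN₁⟩ := hQ₁.exists_subset
  refine ae_restrict_of_ae_restrict_of_subset (hN₁ (N₀ + N₁ + 1) (by omega)) ?_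
  have hsub := hN₀ (N₀ + N₁ + 1) (by omega)
  set Q := closedCube (WithLp.toLp 2 fun _ : Fin n => -((N₀ + N₁ + 1 : ℕ) : ℝ))
    (2 * (N₀ + N₁ + 1 : ℕ))
  have hQ : IsCube Q := isCube_closedCube _ (by positivity)
  have hprod : ∏ i, avg Q (fun x => w i x ^ (-(P i).conjExponent)) ^ (q / (P i).conjExponent)
      = ∞ := by
    rw [← Finset.mul_prod_erase _ _ (Finset.mem_univ i₀)]
    refine ENNReal.mul_eq_top.2 (Or.inr ⟨?_, Finset.prod_ne_zero_iff.2 fun i _ =>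
      avg_dual_weight_rpow_ne_zero (hP i) hq (hw i) (hw' i) hQ⟩)
    have : ∫⁻ x in Q, w i₀ x ^ (-(P i₀).conjExponent) = ∞ := by
      rw [eq_top_iff, ← hinf]
      exact lintegral_mono_set hsub
    rw [avg, this, ENNReal.top_div_of_ne_top hQ.volume_ne_top]
    exact ENNReal.top_rpow_of_pos (div_pos hq (conjExponent_pos (hP i₀)))
  have hle := (le_APqConst P q w hQ).trans_lt hA
  refine ae_eq_zero_of_avg_eq_zero (aemeasurable_prod_weight hw) hQ ?_
  by_contra h
  rw [hprod, ENNReal.mul_top h] at hle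
  exact lt_irrefl _ hle

/-- The weight constant vanishes only if the product weight vanishes almost everywhere. -/
lemma ae_prod_weight_eq_zero_of_APqConst_eq_zero {P : Fin m → ℝ} {q : ℝ}
    {w : Fin m → E n → ℝ≥0∞} (hP : ∀ i, 1 < P i) (hq : 0 < q)
    (hw : ∀ i, AEMeasurable (w i) volume) (hw' : ∀ i x, w i x ≠ ∞) (h0 : APqConst P q w = 0) :
    ∀ᵐ x, (∏ i, w i x) ^ q = 0 := by
  refine ae_of_forall_isCube fun Q hQ =>
    ae_eq_zero_of_avg_eq_zero (aemeasurable_prod_weight hw) hQ ?_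
  have hle := le_APqConst P q w hQ
  rw [h0, nonpos_iff_eq_zero, mul_eq_zero] at hle
  exact hle.resolve_right (Finset.prod_ne_zero_iff.2 fun i _ =>
    avg_dual_weight_rpow_ne_zero (hP i) hq (hw i) (hw' i) hQ)

lemma AInftyConst_ne_zero {σ : E n → ℝ≥0∞} (hσ : AEMeasurable σ volume) (hσ0 : ∀ x, σ x ≠ 0)
    (hfin : ∀ Q : Set (E n), IsCube Q → ∫⁻ x in Q, σ x ≠ ∞) : AInftyConst σ ≠ 0 := by
  intro h0
  have hQ : IsCube (closedCube (0 : E n) 1) := isCube_closedCube _ one_pos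
  set Q := closedCube (0 : E n) 1
  have hle := le_AInftyConst σ hQ
  rw [h0, nonpos_iff_eq_zero, ENNReal.div_eq_zero_iff] at hle
  have hHL := hle.resolve_right (hfin Q hQ)
  have havg : avg Q (Q.indicator σ) ≠ 0 := by
    rw [avg, setLIntegral_indicator hQ.measurableSet, Set.inter_self]
    exact (ENNReal.div_pos (setLIntegral_ne_zero hQ.volume_ne_zero hσ hσ0) hQ.volume_ne_top).ne'
  have hmono : ∫⁻ _ in Q, avg Q (Q.indicator σ) ≤ ∫⁻ x in Q, hardyLittlewood (Q.indicator σ) x :=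
    setLIntegral_mono' hQ.measurableSet fun x hx => avg_le_hardyLittlewood _ hQ hx
  rw [hHL, setLIntegral_const, nonpos_iff_eq_zero, mul_eq_zero] at hmono
  exact hmono.elim havg hQ.volume_ne_zero

lemma ae_ne_top_of_forall_isCube {σ : E n → ℝ≥0∞} (hσ : AEMeasurable σ volume)
    (hfin : ∀ Q : Set (E n), IsCube Q → ∫⁻ x in Q, σ x ≠ ∞) : ∀ᵐ x, σ x ≠ ∞ :=
  ae_of_forall_isCube fun Q hQ => (ae_lt_top' hσ.restrict (hfin Q hQ)).mono fun _ hx => hx.ne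

lemma ne_zero_of_dual_weight_ne_top {w : ℝ≥0∞} {p : ℝ} (hp : 1 < p)
    (h : w ^ (-p.conjExponent) ≠ ∞) : w ≠ 0 := by
  rintro rfl
  exact h (ENNReal.zero_rpow_of_neg (by linarith [conjExponent_pos hp]))

/-- The multilinear weighted estimate on one shifted grid. -/
lemma lintegral_grid_le {P : Fin m → ℝ} {q γ : ℝ} {w : Fin m → E n → ℝ≥0∞}
    {g : Fin m → E n → ℝ≥0∞} (hP : ∀ i, 1 < P i) (hq : 0 < q) (hPq : 1 ≤ ∑ i, q / P i)
    (hγ : 0 < γ) (hγm : γ ≤ m) (hexp : q * γ = 1 + ∑ i, q / (P i).conjExponent)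
    (hw : ∀ i, AEMeasurable (w i) volume) (hw' : ∀ i x, w i x ≠ ∞)
    (hfin : ∀ i, ∀ Q : Set (E n), IsCube Q → ∫⁻ x in Q, w i x ^ (-(P i).conjExponent) ≠ ∞)
    (hg : ∀ i, AEMeasurable (g i) volume) (hgP : ∀ i, ∫⁻ x, g i x ^ P i * w i x ^ P i ≠ ∞)
    (t : Fin n → Bool) (K : ℕ) :
    ∫⁻ x, (⨆ j, (dyadicGrid t K).normalizedProd volume (fun _ => volume) g γ
        ((dyadicGrid t K).cellAt j x)) ^ (q * γ) ∂(volume.withDensity fun x => (∏ i, w i x) ^ q) ≤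
      2 ^ (q * γ) * (APqConst P q w * ∏ i, (ENNReal.ofReal (P i * 2 ^ P i / (P i - 1)) *
        (4 * AInftyConst fun x => w i x ^ (-(P i).conjExponent)) *
        ∫⁻ x, g i x ^ P i * w i x ^ P i) ^ (q / P i)) := by
  set G := dyadicGrid t K with hG
  set σ : Fin m → E n → ℝ≥0∞ := fun i x => w i x ^ (-(P i).conjExponent) with hσdef
  have hσm : ∀ i, AEMeasurable (σ i) volume := fun i => (hw i).pow_const _
  have hσ0 : ∀ i x, σ i x ≠ 0 := fun i x =>
    dual_weight_ne_zero (hw' i x) _ (conjExponent_pos (hP i))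
  have hσtop : ∀ i, ∀ᵐ x, σ i x ≠ ∞ := fun i => ae_ne_top_of_forall_isCube (hσm i) (hfin i)
  -- The function `g i` is written as `h i` times the dual weight.
  have hhm : ∀ i, AEMeasurable (fun x => g i x * (σ i x)⁻¹) volume := fun i =>
    (hg i).mul (hσm i).inv
  set h : Fin m → E n → ℝ≥0∞ := fun i => (hhm i).mk
  have hhmeas : ∀ i, Measurable (h i) := fun i => (hhm i).measurable_mk
  have hgh : ∀ i, ∀ᵐ x, σ i x * h i x = g i x := fun i => by
    filter_upwards [hσtop i, (hhm i).ae_eq_mk] with x hx hx2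
    rw [show h i x = g i x * (σ i x)⁻¹ from hx2.symm, mul_left_comm,
      ENNReal.mul_inv_cancel (hσ0 i x) hx, mul_one]
  have hghP : ∀ i, ∀ᵐ x, σ i x * h i x ^ P i = g i x ^ P i * w i x ^ P i := fun i => by
    filter_upwards [hσtop i, (hhm i).ae_eq_mk] with x hx hx2
    have hPi : 0 < P i := by linarith [hP i]
    have hw0 : w i x ≠ 0 := ne_zero_of_dual_weight_ne_top (hP i) hx
    rw [show h i x = g i x * (σ i x)⁻¹ from hx2.symm, ENNReal.mul_rpow_of_nonneg _ _ hPi.le,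
      mul_left_comm, hσdef]
    congr 1
    simp only
    rw [← ENNReal.rpow_neg, neg_neg, ← ENNReal.rpow_mul, ← ENNReal.rpow_add _ _ hw0 (hw' i x)]
    congr 1
    have : P i - 1 ≠ 0 := by linarith [hP i]
    rw [Real.conjExponent]
    field_simp
    ring
  have hcellm := G.measurableSet_cell
  have hint : ∀ i c, ∫⁻ x in G.cell c, h i x ∂(volume.withDensity (σ i)) =
      ∫⁻ x in G.cell c, g i x := fun i c => by
    rw [restrict_withDensity (hcellm c),
      lintegral_withDensity_eq_lintegral_mul₀ (hσm i).restrict (hhmeas i).aemeasurable]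
    exact lintegral_congr_ae (ae_restrict_of_ae (hgh i))
  have hintP : ∀ i, ∫⁻ x, h i x ^ P i ∂(volume.withDensity (σ i)) =
      ∫⁻ x, g i x ^ P i * w i x ^ P i := fun i => by
    rw [lintegral_withDensity_eq_lintegral_mul₀ (hσm i) ((hhmeas i).pow_const _).aemeasurable]
    exact lintegral_congr_ae (hghP i)
  have hcell : ∀ (f : E n → ℝ≥0∞) c, ∫⁻ x in G.cell c, f x =
      ∫⁻ x in closedCube (corner t K c) (side K c.1), f x := fun f c =>
    setLIntegral_congr (cell_ae_eq t K c)
  have hvol : ∀ c, volume (G.cell c) = volume (closedCube (corner t K c) (side K c.1)) := fun c =>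
    measure_congr (cell_ae_eq t K c)
  have hcube : ∀ c, IsCube (closedCube (corner t K c) (side K c.1)) := fun c =>
    isCube_closedCube _ (side_pos _ _)
  have hσcell : ∀ i c, volume.withDensity (σ i) (G.cell c) =
      ∫⁻ x in closedCube (corner t K c) (side K c.1), σ i x := fun i c => by
    rw [withDensity_apply _ (hcellm c), hcell]
  have hσpos : ∀ i c, ∫⁻ x in closedCube (corner t K c) (side K c.1), σ i x ≠ 0 := fun i c =>
    setLIntegral_ne_zero (hcube c).volume_ne_zero (hσm i) (hσ0 i)
  have hprod : G.normalizedProd volume (fun _ => volume) g γ =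
      G.normalizedProd volume (fun i => volume.withDensity (σ i)) h γ := by
    funext c
    simp only [NestedGrid.normalizedProd, hint]
  rw [hprod]
  refine (NestedGrid.lintegral_iSup_normalizedProd_le _ hhmeas P
    (fun i => AInftyConst (σ i)) (W := APqConst P q w) hP hq hPq hγ hγm hexp
    ?_ ?_ ?_ ?_ ?_ ?_ ?_).trans_eq ?_
  · exact fun c => by rw [hvol]; exact (hcube c).volume_ne_top
  · exact fun c => by rw [hvol]; exact (hcube c).volume_ne_zero
  · exact fun i c => by rw [hσcell]; exact hfin i _ (hcube c)
  · exact fun i c => by rw [hσcell]; exact hσpos i c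
  · -- The integral over a cell is finite since `h ≤ 1 + h ^ P` and the dual weight is finite there.
    intro i c
    have hPi : 0 < P i := by linarith [hP i]
    have hle : ∀ y : ℝ≥0∞, y ≤ 1 + y ^ P i := fun y => by
      rcases le_total y 1 with hy | hy
      · exact hy.trans le_self_add
      · refine le_trans ?_ le_add_self
        conv_lhs => rw [← ENNReal.rpow_one y]
        exact ENNReal.rpow_le_rpow_of_exponent_le hy (hP i).le
    refine ne_top_of_le_ne_top ?_ (lintegral_mono fun x => hle (h i x))
    rw [lintegral_add_left measurable_const, setLIntegral_one, hσcell]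
    refine ENNReal.add_ne_top.2 ⟨hfin i _ (hcube c), ?_⟩
    refine ne_top_of_le_ne_top (hgP i) ?_
    rw [← hintP]
    exact lintegral_mono' Measure.restrict_le_self le_rfl
  · intro c
    have hle := le_APqConst P q w (hcube c)
    refine le_trans (le_of_eq ?_) hle
    simp only [hσcell]
    rw [withDensity_apply _ (hcellm c), hcell, hvol]
    rfl
  · intro i R
    set Q := closedCube (corner t K R) (side K R.1) with hQ
    refine ⟨hardyLittlewood (Q.indicator (σ i)), fun c hc x hx => ?_, ?_⟩
    · have hle := avg_le_hardyLittlewood (Q.indicator (σ i)) (hcube c)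
        (cell_subset_closedCube t K c hx)
      refine le_trans (le_of_eq ?_) hle
      rw [avg, withDensity_apply _ (hcellm c), ← hcell, ← hvol]
      congr 1
      refine setLIntegral_congr_fun (hcellm c) fun y hy => ?_
      exact (Set.indicator_of_mem (cell_subset_closedCube t K R (hc hy)) _).symm
    · rw [hcell, hσcell]
      have hle := le_AInftyConst (σ i) (hcube R)
      exact (ENNReal.div_le_iff (hσpos i R) (hfin i _ (hcube R))).1 hle
  · simp only [hintP]
    rfl

lemma measurable_iSup_normalizedProd (μ : Measure (E n)) (σ : Fin m → Measure (E n))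
    (g : Fin m → E n → ℝ≥0∞) (γ : ℝ) (t : Fin n → Bool) (K : ℕ) :
    Measurable fun x => ⨆ j, (dyadicGrid t K).normalizedProd μ σ g γ
      ((dyadicGrid t K).cellAt j x) := by
  refine Measurable.iSup fun j => ?_
  have h1 : Measurable ((dyadicGrid t K).idx j) :=
    measurable_to_countable' fun v => (dyadicGrid t K).measurableSet_fiber j v
  exact (Measurable.of_discrete (f := fun v => (dyadicGrid t K).normalizedProd μ σ g γ (j, v))).comp
    h1

/-- Enlarging the top scale only adds cells, as level `j` of one grid is level `j + 1` of the
next. -/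
lemma monotone_iSup_normalizedProd (μ : Measure (E n)) (σ : Fin m → Measure (E n))
    (g : Fin m → E n → ℝ≥0∞) (γ : ℝ) (t : Fin n → Bool) (x : E n) :
    Monotone fun K => ⨆ j, (dyadicGrid t K).normalizedProd μ σ g γ
      ((dyadicGrid t K).cellAt j x) := by
  refine monotone_nat_of_le_succ fun K => iSup_le fun j => le_iSup_of_le (j + 1) (le_of_eq ?_)
  simp only [NestedGrid.normalizedProd, cellAt_succ]

/-- The fractional maximal function is dominated by its analogues on the shifted grids. -/
lemma fractionalMaximal_rpow_le {γ q : ℝ} (hγ : 0 < γ) (hq : 0 < q) (g : Fin m → E n → ℝ≥0∞)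
    (x : E n) :
    fractionalMaximal γ g x ^ q ≤ (12 ^ n) ^ (q * γ) * ∑ t : Fin n → Bool, ⨆ K : ℕ,
      (⨆ j, (dyadicGrid t K).normalizedProd volume (fun _ => volume) g γ
        ((dyadicGrid t K).cellAt j x)) ^ (q * γ) := by
  rw [← ENNReal.le_rpow_inv_iff hq]
  refine iSup_le fun Q => iSup_le fun hQ => iSup_le fun hx => ?_
  rw [ENNReal.le_rpow_inv_iff hq]
  obtain ⟨t, K, j, hsub, hvol⟩ := hQ.exists_cell
  set G := dyadicGrid t K
  set c := G.cellAt j x with hc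
  have hcv : volume (G.cell c) ≤ 12 ^ n * volume Q := by
    rw [volume_cell]
    exact hvol
  have hc0 : volume (G.cell c) ≠ 0 := by
    rw [volume_cell]
    exact pow_ne_zero _ (by simpa using side_pos K _)
  have hct : volume (G.cell c) ≠ ∞ := by
    rw [volume_cell]
    exact ENNReal.pow_ne_top ENNReal.ofReal_ne_top
  have hqγ : 0 < q * γ := by positivity
  have key : ((∏ i, ∫⁻ y in Q, g i y) / volume Q ^ γ) ^ q ≤
      (12 ^ n) ^ (q * γ) * G.normalizedProd volume (fun _ => volume) g γ c ^ (q * γ) := by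
    rw [NestedGrid.normalizedProd_rpow hγ c hq.le, ENNReal.div_rpow_of_nonneg _ _ hq.le,
      ← ENNReal.rpow_mul, mul_comm γ q, ← ENNReal.prod_rpow_of_nonneg hq.le]
    have h1 : volume (G.cell c) ^ (q * γ) ≤ (12 ^ n) ^ (q * γ) * volume Q ^ (q * γ) := by
      rw [← ENNReal.mul_rpow_of_nonneg _ _ hqγ.le]
      gcongr
    have h2 : ∏ i, (∫⁻ y in Q, g i y) ^ q ≤ ∏ i, (∫⁻ y in G.cell c, g i y) ^ q :=
      Finset.prod_le_prod' fun i _ =>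
        ENNReal.rpow_le_rpow (lintegral_mono_set (hsub x hx)) hq.le
    have hQ0 : volume Q ^ (q * γ) ≠ 0 :=
      (ENNReal.rpow_pos (pos_iff_ne_zero.2 hQ.volume_ne_zero) hQ.volume_ne_top).ne'
    have hQt : volume Q ^ (q * γ) ≠ ∞ := ENNReal.rpow_ne_top_of_nonneg hqγ.le hQ.volume_ne_top
    have hC0 : volume (G.cell c) ^ (q * γ) ≠ 0 :=
      (ENNReal.rpow_pos (pos_iff_ne_zero.2 hc0) hct).ne'
    have hCt : volume (G.cell c) ^ (q * γ) ≠ ∞ := ENNReal.rpow_ne_top_of_nonneg hqγ.le hct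
    rw [ENNReal.div_le_iff hQ0 hQt, mul_right_comm, ← mul_div_assoc,
      ENNReal.le_div_iff_mul_le (Or.inl hC0) (Or.inl hCt), mul_comm]
    exact mul_le_mul' h1 h2
  refine key.trans (mul_le_mul_right ?_ _)
  refine le_trans ?_ (Finset.single_le_sum (f := fun t : Fin n → Bool => ⨆ K : ℕ,
      (⨆ j, (dyadicGrid t K).normalizedProd volume (fun _ => volume) g γ
        ((dyadicGrid t K).cellAt j x)) ^ (q * γ)) (fun _ _ => bot_le) (Finset.mem_univ t))
  refine le_iSup_of_le K (ENNReal.rpow_le_rpow ?_ hqγ.le)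
  exact le_iSup (fun j => G.normalizedProd volume (fun _ => volume) g γ (G.cellAt j x)) j

/-- Uniform estimates on the shifted grids pass to the fractional maximal function, by monotone
convergence in the top scale. -/
lemma lintegral_fractionalMaximal_le {q γ : ℝ} (hq : 0 < q) (hγ : 0 < γ)
    {w : Fin m → E n → ℝ≥0∞} (hw : ∀ i, AEMeasurable (w i) volume) (g : Fin m → E n → ℝ≥0∞)
    {B : ℝ≥0∞} (hB : ∀ (t : Fin n → Bool) (K : ℕ),
      ∫⁻ x, (⨆ j, (dyadicGrid t K).normalizedProd volume (fun _ => volume) g γ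
        ((dyadicGrid t K).cellAt j x)) ^ (q * γ)
          ∂(volume.withDensity fun x => (∏ i, w i x) ^ q) ≤ B) :
    ∫⁻ x, fractionalMaximal γ g x ^ q * (∏ i, w i x) ^ q ≤
      (12 ^ n) ^ (q * γ) * (2 ^ n * B) := by
  have hqγ : 0 < q * γ := by positivity
  set S : (Fin n → Bool) → ℕ → E n → ℝ≥0∞ := fun t K x =>
    (⨆ j, (dyadicGrid t K).normalizedProd volume (fun _ => volume) g γ
      ((dyadicGrid t K).cellAt j x)) ^ (q * γ) with hS
  have hSm : ∀ t K, Measurable (S t K) := fun t K =>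
    (measurable_iSup_normalizedProd _ _ _ _ t K).pow_const _
  have hsupm : ∀ t, Measurable fun x => ⨆ K, S t K x := fun t => Measurable.iSup (hSm t)
  calc ∫⁻ x, fractionalMaximal γ g x ^ q * (∏ i, w i x) ^ q
      ≤ ∫⁻ x, (∏ i, w i x) ^ q * ((12 ^ n) ^ (q * γ) * ∑ t, ⨆ K, S t K x) := by
        refine lintegral_mono fun x => ?_
        simp only
        rw [mul_comm]
        gcongr
        exact fractionalMaximal_rpow_le hγ hq g x
    _ = ∫⁻ x, (12 ^ n) ^ (q * γ) * ∑ t, ⨆ K, S t K x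
          ∂(volume.withDensity fun x => (∏ i, w i x) ^ q) :=
        (lintegral_withDensity_eq_lintegral_mul₀ (aemeasurable_prod_weight hw)
          ((Finset.measurable_fun_sum _ fun t _ => hsupm t).const_mul _).aemeasurable).symm
    _ = (12 ^ n) ^ (q * γ) * ∑ t, ⨆ K, ∫⁻ x, S t K x
          ∂(volume.withDensity fun x => (∏ i, w i x) ^ q) := by
        rw [lintegral_const_mul _ (Finset.measurable_fun_sum _ fun t _ => hsupm t),
          lintegral_finsetSum _ fun t _ => hsupm t]
        congr 1
        refine Finset.sum_congr rfl fun t _ => lintegral_iSup (hSm t) fun K L hKL x => ?_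
        exact ENNReal.rpow_le_rpow (monotone_iSup_normalizedProd _ _ g γ t x hKL) hqγ.le
    _ ≤ (12 ^ n) ^ (q * γ) * ∑ _t : Fin n → Bool, B := by
        gcongr with t
        exact iSup_le fun K => hB t K
    _ = _ := by simp

/-- The mixed `A_{(P,q)}`-`A_∞` bound for the multilinear fractional maximal function. -/
theorem weightedLpNorm_fractionalMaximal_le (m n : ℕ) {P : Fin m → ℝ} {q γ : ℝ}
    (hP : ∀ i, 1 < P i) (hq : 0 < q) (hPq : 1 ≤ ∑ i, q / P i) (hγ : 0 < γ) (hγm : γ ≤ m)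
    (hexp : q * γ = 1 + ∑ i, q / (P i).conjExponent) :
    ∃ C : ℝ≥0∞, C ≠ ∞ ∧ ∀ w : Fin m → E n → ℝ≥0∞, (∀ i, AEMeasurable (w i) volume) →
      (∀ i x, w i x ≠ ∞) → MemAPq P q w → ∀ g : Fin m → E n → ℝ≥0∞,
      (∀ i, AEMeasurable (g i) volume) →
      weightedLpNorm q (fractionalMaximal γ g) (fun x => (∏ i, w i x) ^ q) ≤
        C * APqConst P q w ^ (1 / q) *
          (∏ i, AInftyConst (fun x => w i x ^ (-(P i).conjExponent)) ^ (1 / P i)) *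
          ∏ i, weightedLpNorm (P i) (g i) (fun x => w i x ^ P i) := by
  have hPpos : ∀ i, 0 < P i := fun i => by linarith [hP i]
  set κ : Fin m → ℝ≥0∞ := fun i => ENNReal.ofReal (P i * 2 ^ P i / (P i - 1)) * 4 with hκ
  have hκpos : ∀ i, 0 < κ i := fun i => by
    have h1 : 0 < P i - 1 := by linarith [hP i]
    have h2 := hPpos i
    refine ENNReal.mul_pos ?_ (by simp)
    simp only [ne_eq, ENNReal.ofReal_eq_zero, not_le]
    positivity
  have hκtop : ∀ i, κ i ≠ ∞ := fun i => ENNReal.mul_ne_top ENNReal.ofReal_ne_top (by simp)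
  set C : ℝ≥0∞ := ((12 ^ n) ^ (q * γ) * (2 ^ n * 2 ^ (q * γ))) ^ (1 / q) *
    ∏ i, κ i ^ (1 / P i) with hC
  have h12 : ((12 : ℝ≥0∞) ^ n) ≠ ∞ := ENNReal.pow_ne_top (by simp)
  have hC0 : C ≠ 0 := by
    refine mul_ne_zero (ENNReal.rpow_pos ?_ ?_).ne' (Finset.prod_ne_zero_iff.2 fun i _ =>
      (ENNReal.rpow_pos (hκpos i) (hκtop i)).ne')
    · refine ENNReal.mul_pos (ENNReal.rpow_pos (by positivity) h12).ne'
        (mul_ne_zero (by positivity) ?_)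
      exact (ENNReal.rpow_pos (by simp) (by simp)).ne'
    · exact ENNReal.mul_ne_top (ENNReal.rpow_ne_top_of_nonneg (by positivity) h12)
        (ENNReal.mul_ne_top (ENNReal.pow_ne_top (by simp))
          (ENNReal.rpow_ne_top_of_nonneg (by positivity) (by simp)))
  refine ⟨C, ?_, fun w hw hw' hA g hg => ?_⟩
  · refine ENNReal.mul_ne_top (ENNReal.rpow_ne_top_of_nonneg (by positivity) ?_)
      (ENNReal.prod_ne_top fun i _ => ENNReal.rpow_ne_top_of_nonneg
        (one_div_pos.2 (hPpos i)).le (hκtop i))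
    exact ENNReal.mul_ne_top (ENNReal.rpow_ne_top_of_nonneg (by positivity) h12)
        (ENNReal.mul_ne_top (ENNReal.pow_ne_top (by simp))
          (ENNReal.rpow_ne_top_of_nonneg (by positivity) (by simp)))
  have hzero : (∀ᵐ x, (∏ i, w i x) ^ q = 0) →
      weightedLpNorm q (fractionalMaximal γ g) (fun x => (∏ i, w i x) ^ q) = 0 := fun h => by
    have : ∫⁻ x, fractionalMaximal γ g x ^ q * (∏ i, w i x) ^ q = 0 := by
      rw [← lintegral_zero (μ := (volume : Measure (E n)))]
      exact lintegral_congr_ae (h.mono fun x hx => by simp only [hx, mul_zero])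
    rw [weightedLpNorm, this]
    exact ENNReal.zero_rpow_of_pos (by positivity)
  by_cases hν : ∀ᵐ x, (∏ i, w i x) ^ q = 0
  · rw [hzero hν]
    exact bot_le
  set σ : Fin m → E n → ℝ≥0∞ := fun i x => w i x ^ (-(P i).conjExponent) with hσ
  have hσm : ∀ i, AEMeasurable (σ i) volume := fun i => (hw i).pow_const _
  have hfin : ∀ i, ∀ Q : Set (E n), IsCube Q → ∫⁻ x in Q, σ i x ≠ ∞ := fun i Q hQ hinf =>
    hν (ae_prod_weight_eq_zero hP hq hw hw' hA hQ hinf)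
  by_cases hN : ∃ i, ∫⁻ x, g i x ^ P i * w i x ^ P i = ∞
  · -- Either some `g j` vanishes almost everywhere, or the right-hand side is infinite.
    by_cases hN0 : ∃ j, ∫⁻ x, g j x ^ P j * w j x ^ P j = 0
    · obtain ⟨j, hj⟩ := hN0
      have hgj : ∀ᵐ x, g j x = 0 := by
        have hgw : AEMeasurable (fun x => g j x ^ P j * w j x ^ P j) volume :=
          ((hg j).pow_const _).mul ((hw j).pow_const _)
        rw [lintegral_eq_zero_iff' hgw] at hj
        filter_upwards [hj, ae_ne_top_of_forall_isCube (hσm j) (hfin j)] with x hx hx2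
        have hw0 := ne_zero_of_dual_weight_ne_top (hP j) hx2
        simp only [Pi.zero_apply, mul_eq_zero] at hx
        rcases hx with hx | hx
        · exact ((ENNReal.rpow_eq_zero_iff_of_pos (hPpos j)).1 hx)
        · exact absurd ((ENNReal.rpow_eq_zero_iff_of_pos (hPpos j)).1 hx) hw0
      have hM : ∀ x, fractionalMaximal γ g x = 0 := fun x => by
        simp only [fractionalMaximal, ENNReal.iSup_eq_zero]
        intro Q hQ _
        have : ∫⁻ y in Q, g j y = 0 := by
          rw [← lintegral_zero (μ := (volume : Measure (E n)).restrict Q)]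
          exact lintegral_congr_ae (ae_restrict_of_ae hgj)
        rw [Finset.prod_eq_zero (Finset.mem_univ j) this, ENNReal.zero_div]
      simp only [weightedLpNorm, hM, ENNReal.zero_rpow_of_pos hq, zero_mul, lintegral_zero]
      rw [ENNReal.zero_rpow_of_pos (by positivity)]
      exact bot_le
    · obtain ⟨i₀, hi₀⟩ := hN
      push Not at hN0
      refine le_of_le_of_eq le_top (Eq.symm (ENNReal.mul_eq_top.2 (Or.inl ⟨?_, ?_⟩)))
      · refine mul_ne_zero (mul_ne_zero hC0 ?_) (Finset.prod_ne_zero_iff.2 fun i _ => ?_)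
        · refine (ENNReal.rpow_pos_of_nonneg (pos_iff_ne_zero.2 fun h0 => hν ?_)
            (by positivity)).ne'
          exact ae_prod_weight_eq_zero_of_APqConst_eq_zero hP hq hw hw' h0
        · exact (ENNReal.rpow_pos_of_nonneg (pos_iff_ne_zero.2 (AInftyConst_ne_zero (hσm i)
            (fun x => dual_weight_ne_zero (hw' i x) _ (conjExponent_pos (hP i))) (hfin i)))
            (one_div_pos.2 (hPpos i)).le).ne'
      · rw [← Finset.mul_prod_erase _ _ (Finset.mem_univ i₀)]
        refine ENNReal.mul_eq_top.2 (Or.inr ⟨?_, Finset.prod_ne_zero_iff.2 fun i _ => ?_⟩)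
        · rw [weightedLpNorm, hi₀]
          exact ENNReal.top_rpow_of_pos (one_div_pos.2 (hPpos i₀))
        · exact (ENNReal.rpow_pos_of_nonneg (pos_iff_ne_zero.2 (hN0 i))
            (one_div_pos.2 (hPpos i)).le).ne'
  push Not at hN
  have main := lintegral_fractionalMaximal_le hq hγ hw g fun t K =>
    lintegral_grid_le hP hq hPq hγ hγm hexp hw hw' hfin hg hN t K
  refine (ENNReal.rpow_le_rpow main (one_div_pos.2 hq).le).trans (le_of_eq ?_)
  have e1 : ∀ (i : Fin m) (y z : ℝ≥0∞), ((ENNReal.ofReal (P i * 2 ^ P i / (P i - 1)) * (4 * y) *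
      z) ^ (q / P i)) ^ (1 / q) = κ i ^ (1 / P i) * y ^ (1 / P i) * z ^ (1 / P i) := by
    intro i y z
    have h0 : 0 ≤ 1 / P i := (one_div_pos.2 (hPpos i)).le
    rw [← ENNReal.rpow_mul, show q / P i * (1 / q) = 1 / P i by field_simp,
      ← mul_assoc, ENNReal.mul_rpow_of_nonneg _ _ h0, ENNReal.mul_rpow_of_nonneg _ _ h0]
  have hq' : 0 ≤ 1 / q := by positivity
  calc _ = ((12 ^ n) ^ (q * γ) * (2 ^ n * 2 ^ (q * γ)) * APqConst P q w *
        ∏ i, (ENNReal.ofReal (P i * 2 ^ P i / (P i - 1)) * (4 * AInftyConst (σ i)) *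
          ∫⁻ x, g i x ^ P i * w i x ^ P i) ^ (q / P i)) ^ (1 / q) := by
        congr 1
        ring
    _ = _ := by
        rw [ENNReal.mul_rpow_of_nonneg _ _ hq', ENNReal.mul_rpow_of_nonneg _ _ hq',
          ← ENNReal.prod_rpow_of_nonneg hq']
        simp only [e1, Finset.prod_mul_distrib]
        rw [hC]
        simp only [weightedLpNorm]
        ring

/-! ### Integrals of homogeneous kernels over boxes -/

/-- Tonelli's theorem for a product of functions of separate variables. -/
lemma lintegral_pi_prod_eq {X : Type*} [MeasurableSpace X] (μ : Measure X) [SigmaFinite μ] {m : ℕ}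
    {f : Fin m → X → ℝ≥0∞} (hf : ∀ i, AEMeasurable (f i) μ) :
    ∫⁻ y, ∏ i, f i (y i) ∂(Measure.pi fun _ : Fin m => μ) = ∏ i, ∫⁻ x, f i x ∂μ := by
  induction m with
  | zero => simp
  | succ m ih =>
    have hmp := (measurePreserving_piFinSuccAbove (fun _ : Fin (m + 1) => μ) 0).symm
    rw [MeasurePreserving.lintegral_map_equiv _ _ hmp, Fin.prod_univ_succ,
      ← ih fun i => hf i.succ, ← lintegral_prod_mul (hf 0)
      (Finset.aemeasurable_fun_prod _ fun i _ =>
      (hf i.succ).comp_quasiMeasurePreserving (Measure.quasiMeasurePreserving_eval _ i))]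
    refine lintegral_congr fun z => ?_
    rw [Fin.prod_univ_succ]
    rfl

section Direction

variable {F : Type*} [NormedAddCommGroup F] [NormedSpace ℝ F]

/-- The direction `y / |y|` of a vector `y`, as a point of the unit sphere; the direction of the
zero vector is `θ₀`. -/
def direction (θ₀ : Metric.sphere (0 : F) 1) (y : F) : Metric.sphere (0 : F) 1 :=
  open scoped Classical in
  ⟨if y = 0 then θ₀ else ‖y‖⁻¹ • y, by
    split_ifs with h
    · exact θ₀.2
    · simp [norm_smul, h]⟩

lemma coe_direction (θ₀ : Metric.sphere (0 : F) 1) {y : F} (hy : y ≠ 0) :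
    (direction θ₀ y : F) = ‖y‖⁻¹ • y := if_neg hy

open scoped Pointwise in
lemma direction_preimage_inter_ball (θ₀ : Metric.sphere (0 : F) 1) {R : ℝ} (hR : 0 < R)
    (s : Set (Metric.sphere (0 : F) 1)) :
    (direction θ₀ ⁻¹' s ∩ Metric.ball 0 R) \ {0} =
      R • (Set.Ioo (0 : ℝ) 1 • (Subtype.val '' s)) := by
  ext y
  simp only [Set.mem_sdiff, Set.mem_inter_iff, Set.mem_preimage, mem_ball_zero_iff,
    Set.mem_singleton_iff, Set.mem_smul_set, Set.mem_smul]
  constructor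
  · rintro ⟨⟨h1, h2⟩, h3⟩
    have hn : 0 < ‖y‖ := norm_pos_iff.2 h3
    refine ⟨R⁻¹ • y, ⟨‖y‖ / R, ⟨by positivity, (div_lt_one hR).2 h2⟩, direction θ₀ y,
      ⟨_, h1, rfl⟩, ?_⟩, ?_⟩
    · rw [coe_direction θ₀ h3, smul_smul]
      congr 1
      field_simp
    · rw [smul_smul, mul_inv_cancel₀ hR.ne', one_smul]
  · rintro ⟨z, ⟨r, ⟨hr0, hr1⟩, -, ⟨θ, hθ, rfl⟩, rfl⟩, rfl⟩
    have hθn : ‖(θ : F)‖ = 1 := by simp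
    have hθ0 : (θ : F) ≠ 0 := fun h => by simp [h] at hθn
    have hnorm : ‖R • r • (θ : F)‖ = R * r := by
      rw [norm_smul, norm_smul, hθn, Real.norm_of_nonneg hR.le, Real.norm_of_nonneg hr0.le, mul_one]
    have hne : R • r • (θ : F) ≠ 0 := smul_ne_zero hR.ne' (smul_ne_zero hr0.ne' hθ0)
    have hdir : direction θ₀ (R • r • (θ : F)) = θ := by
      refine Subtype.ext ?_
      rw [coe_direction θ₀ hne, hnorm, smul_smul, smul_smul]
      have : (R * r)⁻¹ * (R * r) = 1 := inv_mul_cancel₀ (by positivity)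
      rw [mul_assoc, this, one_smul]
    refine ⟨⟨by rwa [hdir], ?_⟩, hne⟩
    rw [hnorm]
    nlinarith

variable [MeasurableSpace F] [BorelSpace F] [FiniteDimensional ℝ F]

lemma measurable_direction (θ₀ : Metric.sphere (0 : F) 1) : Measurable (direction θ₀) := by
  refine Measurable.subtype_mk (Measurable.ite (measurableSet_singleton 0) measurable_const ?_)
  exact measurable_norm.inv.smul measurable_id

lemma ae_ne_zero [Nontrivial F] (μ : Measure F) [μ.IsAddHaarMeasure] : ∀ᵐ y ∂μ, y ≠ 0 :=
  compl_mem_ae_iff.2 (measure_singleton 0)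

/-- The direction map sends Haar measure on a ball to a multiple of the surface measure. -/
lemma measurePreserving_direction [Nontrivial F] (μ : Measure F) [μ.IsAddHaarMeasure]
    (θ₀ : Metric.sphere (0 : F) 1) {R : ℝ} (hR : 0 < R) :
    MeasurePreserving (direction θ₀) (μ.restrict (Metric.ball 0 R))
      ((ENNReal.ofReal R ^ Module.finrank ℝ F / Module.finrank ℝ F) • μ.toSphere) := by
  refine ⟨measurable_direction θ₀, Measure.ext fun s hs => ?_⟩
  have hN : (Module.finrank ℝ F : ℝ≥0∞) ≠ 0 := by
    exact_mod_cast (Module.finrank_pos (R := ℝ) (M := F)).ne'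
  rw [Measure.map_apply (measurable_direction θ₀) hs,
    Measure.restrict_apply (measurable_direction θ₀ hs),
    ← measure_sdiff_null (measure_singleton (0 : F)), direction_preimage_inter_ball θ₀ hR,
    Measure.addHaar_smul, Measure.smul_apply, smul_eq_mul, Measure.toSphere_apply' μ hs,
    ← mul_assoc, ENNReal.div_mul_cancel hN (ENNReal.natCast_ne_top _), abs_of_pos (by positivity),
    ENNReal.ofReal_pow hR.le]

end Direction

/-- The product of `m` balls of radius `l` centred at the origin. -/
def ballProd (m n : ℕ) (l : ℝ) : Set (Fin m → E n) := Set.univ.pi fun _ => Metric.ball 0 l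

lemma measurableSet_ballProd (m n : ℕ) (l : ℝ) : MeasurableSet (ballProd m n l) :=
  MeasurableSet.univ_pi fun _ => measurableSet_ball

/-- `Ω` is `L^s` on the products of balls, with the norm growth that homogeneity of degree zero
entails. -/
structure HasBoxBound {m n : ℕ} (Ω : (Fin m → E n) → ℂ) (s : ℝ≥0∞) (A : ℝ≥0∞) : Prop where
  aestronglyMeasurable : ∀ l, 0 < l → AEStronglyMeasurable Ω (volume.restrict (ballProd m n l))
  eLpNorm_le : ∀ l, 0 < l → eLpNorm Ω s (volume.restrict (ballProd m n l)) ≤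
    A * ENNReal.ofReal l ^ ((m * n : ℕ) * (1 / s).toReal)

/-- A kernel that is homogeneous of degree zero in each variable is controlled on products of
balls by its restriction to the product of spheres. -/
lemma SeparatelyHomogeneous.exists_hasBoxBound (m n : ℕ) (hn : 0 < n) (s : ℝ≥0∞) :
    ∃ D : ℝ≥0∞, D ≠ ∞ ∧ ∀ Ω : (Fin m → E n) → ℂ, SeparatelyHomogeneous Ω →
      MemLp (onProdSphere Ω) s (prodSphereMeasure m n) →
      HasBoxBound Ω s (D * eLpNorm (onProdSphere Ω) s (prodSphereMeasure m n)) := by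
  have hne : Nonempty (Fin n) := ⟨⟨0, hn⟩⟩
  have hn0 : (n : ℝ≥0∞) ≠ 0 := by exact_mod_cast hn.ne'
  obtain ⟨θ, hθ⟩ := (NormedSpace.sphere_nonempty (E := E n) (x := 0) (r := 1)).2 zero_le_one
  set θ₀ : Metric.sphere (0 : E n) 1 := ⟨θ, hθ⟩
  set c : ℝ → ℝ≥0∞ := fun l => ENNReal.ofReal l ^ n / n with hc
  have hmp : ∀ l, 0 < l → MeasurePreserving (fun (y : Fin m → E n) i => direction θ₀ (y i))
      (volume.restrict (ballProd m n l)) (c l ^ m • prodSphereMeasure m n) := by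
    intro l hl
    have h1 := measurePreserving_direction (volume : Measure (E n)) θ₀ hl
    rw [finrank_euclideanSpace_fin] at h1
    have hfin : IsFiniteMeasure (c l • (volume : Measure (E n)).toSphere) :=
      ⟨by
        rw [Measure.smul_apply, smul_eq_mul]
        exact ENNReal.mul_lt_top (ENNReal.div_lt_top (ENNReal.pow_ne_top ENNReal.ofReal_ne_top) hn0)
          (measure_lt_top _ _)⟩
    have h2 := measurePreserving_pi (fun _ : Fin m => (volume : Measure (E n)).restrict
      (Metric.ball 0 l)) (fun _ => c l • (volume : Measure (E n)).toSphere) fun _ => h1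
    rw [← Measure.restrict_pi_pi] at h2
    have h3 : Measure.pi (fun _ : Fin m => c l • (volume : Measure (E n)).toSphere) =
        c l ^ m • prodSphereMeasure m n := by
      refine Measure.pi_eq fun t _ => ?_
      rw [Measure.smul_apply, prodSphereMeasure, Measure.pi_pi]
      simp [Finset.prod_mul_distrib]
    rw [h3] at h2
    exact h2
  have hnull : ∀ l, ∀ᵐ y ∂((volume : Measure (Fin m → E n)).restrict (ballProd m n l)),
      ∀ i, y i ≠ 0 := fun l => by
    have h0 : ∀ᵐ x : E n, x ≠ 0 := ae_ne_zero volume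
    exact ae_restrict_of_ae (ae_all_iff.2 fun i =>
      (Measure.quasiMeasurePreserving_eval (fun _ : Fin m => (volume : Measure (E n))) i).ae h0)
  refine ⟨((n : ℝ≥0∞)⁻¹ ^ m) ^ (1 / s).toReal, ENNReal.rpow_ne_top_of_nonneg ENNReal.toReal_nonneg
    (ENNReal.pow_ne_top (ENNReal.inv_ne_top.2 hn0)), fun Ω hΩ hmem => ?_⟩
  have hae : ∀ l, Ω =ᵐ[volume.restrict (ballProd m n l)]
      onProdSphere Ω ∘ fun (y : Fin m → E n) i => direction θ₀ (y i) := fun l => by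
    filter_upwards [hnull l] with y hy
    simp only [Function.comp, onProdSphere]
    rw [← hΩ (fun i => ‖y i‖⁻¹) y (fun i => inv_pos.2 (norm_pos_iff.2 (hy i))) hy]
    congr 1
    funext i
    rw [coe_direction θ₀ (hy i)]
  have hsm : ∀ l, AEStronglyMeasurable (onProdSphere Ω) (c l ^ m • prodSphereMeasure m n) :=
    fun l => hmem.1.smul_measure _
  refine ⟨fun l hl => ?_, fun l hl => ?_⟩
  · exact ((hsm l).comp_measurePreserving (hmp l hl)).congr (hae l).symm
  · have hc0 : c l ^ m ≠ 0 := pow_ne_zero _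
      (ENNReal.div_pos (pow_ne_zero _ (by simpa using hl)) (ENNReal.natCast_ne_top _)).ne'
    rw [eLpNorm_congr_ae (hae l), eLpNorm_comp_measurePreserving (hsm l) (hmp l hl),
      eLpNorm_smul_measure_of_ne_zero hc0, smul_eq_mul]
    refine le_of_eq ?_
    have h0 : 0 ≤ (1 / s).toReal := ENNReal.toReal_nonneg
    have hcl : c l ^ m = (n : ℝ≥0∞)⁻¹ ^ m * ENNReal.ofReal l ^ (m * n) := by
      rw [mul_comm m n, pow_mul, ← mul_pow, ← ENNReal.div_eq_inv_mul]
    rw [hcl, ENNReal.mul_rpow_of_nonneg _ _ h0, ENNReal.rpow_mul, ENNReal.rpow_natCast]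
    ring

/-- A kernel that is homogeneous of degree zero under simultaneous dilations is controlled on
products of balls by its restriction to the sphere of the product space. -/
lemma JointlyHomogeneous.exists_hasBoxBound (m n : ℕ) (hm : 0 < m) (hn : 0 < n) (s : ℝ≥0∞) :
    ∃ D : ℝ≥0∞, D ≠ ∞ ∧ ∀ Ω : (Fin m → E n) → ℂ, JointlyHomogeneous Ω →
      MemLp (onJointSphere Ω) s (jointSphereMeasure m n) →
      HasBoxBound Ω s (D * eLpNorm (onJointSphere Ω) s (jointSphereMeasure m n)) := by
  have hne : Nonempty (Fin n) := ⟨⟨0, hn⟩⟩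
  have hne' : Nonempty (Fin m) := ⟨⟨0, hm⟩⟩
  have hrank : Module.finrank ℝ (EProd m n) = m * n := by
    rw [(WithLp.linearEquiv 2 ℝ (Fin m → E n)).finrank_eq, Module.finrank_pi_fintype]
    simp
  have hmn : ((m * n : ℕ) : ℝ≥0∞) ≠ 0 := by exact_mod_cast (Nat.mul_pos hm hn).ne'
  have hnt : Nontrivial (EProd m n) :=
    Module.nontrivial_of_finrank_pos (R := ℝ) (by rw [hrank]; exact Nat.mul_pos hm hn)
  obtain ⟨θ, hθ⟩ := (NormedSpace.sphere_nonempty (E := EProd m n) (x := 0) (r := 1)).2 zero_le_one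
  set θ₀ : Metric.sphere (0 : EProd m n) 1 := ⟨θ, hθ⟩
  -- The product measure and the measure of the Euclidean space `ℝ^{mn}` are Haar measures.
  set L := PiLp.continuousLinearEquiv 2 ℝ (fun _ : Fin m => E n) with hL
  set κ := (volume : Measure (Fin m → E n)).addHaarScalarFactor
    (Measure.map L (volume : Measure (EProd m n))) with hκ
  have hvol : (volume : Measure (Fin m → E n)) =
      κ • Measure.map L (volume : Measure (EProd m n)) := Measure.isAddLeftInvariant_eq_smul _ _
  have hκ0 : (κ : ℝ≥0∞) ≠ 0 := by
    intro h0
    have : (volume : Measure (Fin m → E n)) = 0 := by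
      rw [hvol, ENNReal.coe_eq_zero.1 h0, zero_smul]
    exact NeZero.ne (volume : Measure (Fin m → E n)) this
  have hLm : Measurable L := L.continuous.measurable
  set ρ : ℝ → ℝ := fun l => (m + 1) * l with hρ
  have hρpos : ∀ l, 0 < l → 0 < ρ l := fun l hl => by positivity
  have hball : ∀ l, 0 < l → L ⁻¹' (ballProd m n l) ⊆ Metric.ball 0 (ρ l) := by
    intro l hl y hy
    have hy' : ∀ i, ‖y i‖ < l := fun i => mem_ball_zero_iff.1 (hy i (Set.mem_univ i))
    rw [mem_ball_zero_iff, PiLp.norm_eq_of_L2]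
    refine (Real.sqrt_lt' (hρpos l hl)).2 ?_
    calc ∑ i, ‖y i‖ ^ 2 ≤ ∑ _i : Fin m, l ^ 2 := by
          gcongr with i
          exact (hy' i).le
      _ = m * l ^ 2 := by simp
      _ < ρ l ^ 2 := by
          rw [hρ]
          have : 0 < l ^ 2 := by positivity
          have : (0 : ℝ) ≤ m := Nat.cast_nonneg m
          nlinarith [mul_nonneg (sq_nonneg (m : ℝ)) (sq_nonneg l)]
  have hrestrict : ∀ l, (volume : Measure (Fin m → E n)).restrict (ballProd m n l) =
      (κ : ℝ≥0∞) • Measure.map L ((volume : Measure (EProd m n)).restrict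
        (L ⁻¹' (ballProd m n l))) := by
    intro l
    rw [hvol, Measure.restrict_smul, Measure.restrict_map hLm (measurableSet_ballProd m n l)]
    rfl
  set c : ℝ → ℝ≥0∞ := fun l => ENNReal.ofReal (ρ l) ^ (m * n) / (m * n : ℕ) with hc
  have hmp : ∀ l, 0 < l → MeasurePreserving (direction θ₀)
      ((volume : Measure (EProd m n)).restrict (Metric.ball 0 (ρ l)))
      (c l • jointSphereMeasure m n) := by
    intro l hl
    have h1 := measurePreserving_direction (volume : Measure (EProd m n)) θ₀ (hρpos l hl)
    rwa [hrank] at h1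
  have hτ : 0 ≤ (1 / s).toReal := ENNReal.toReal_nonneg
  refine ⟨(κ : ℝ≥0∞) ^ (1 / s).toReal * ((ENNReal.ofReal (m + 1) ^ (m * n) / (m * n : ℕ)) ^
    (1 / s).toReal), ?_, fun Ω hΩ hmem => ?_⟩
  · exact ENNReal.mul_ne_top (ENNReal.rpow_ne_top_of_nonneg hτ ENNReal.coe_ne_top)
      (ENNReal.rpow_ne_top_of_nonneg hτ
        (ENNReal.div_ne_top (ENNReal.pow_ne_top ENNReal.ofReal_ne_top) hmn))
  have hae : ∀ᵐ y : EProd m n, (Ω ∘ L) y = (onJointSphere Ω ∘ direction θ₀) y := by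
    have h0 : ∀ᵐ y : EProd m n, y ≠ 0 := ae_ne_zero volume
    filter_upwards [h0] with y hy
    simp only [Function.comp, onJointSphere]
    rw [coe_direction θ₀ hy]
    exact (hΩ ‖y‖⁻¹ (L y) (inv_pos.2 (norm_pos_iff.2 hy))).symm
  have hsm : ∀ l, 0 < l → AEStronglyMeasurable (Ω ∘ L)
      ((volume : Measure (EProd m n)).restrict (Metric.ball 0 (ρ l))) := fun l hl =>
    ((hmem.1.smul_measure (c l)).comp_measurePreserving (hmp l hl)).congr
      (ae_restrict_of_ae (hae.mono fun _ hy => hy.symm))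
  have hmap : ∀ l, 0 < l → AEStronglyMeasurable Ω (Measure.map L
      ((volume : Measure (EProd m n)).restrict (L ⁻¹' (ballProd m n l)))) := fun l hl => by
    have hemb : MeasurableEmbedding L := L.toHomeomorph.measurableEmbedding
    rw [hemb.aestronglyMeasurable_map_iff]
    exact (hsm l hl).mono_measure (Measure.restrict_mono (hball l hl) le_rfl)
  refine ⟨fun l hl => ?_, fun l hl => ?_⟩
  · rw [hrestrict l]
    exact (hmap l hl).smul_measure _
  · have hc0 : c l ≠ 0 := by
      refine (ENNReal.div_pos (pow_ne_zero _ ?_) (ENNReal.natCast_ne_top _)).ne'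
      simpa using hρpos l hl
    rw [hrestrict l, eLpNorm_smul_measure_of_ne_zero hκ0, smul_eq_mul,
      eLpNorm_map_measure (hmap l hl) hLm.aemeasurable]
    have h1 : eLpNorm (Ω ∘ L) s ((volume : Measure (EProd m n)).restrict (L ⁻¹' (ballProd m n l))) ≤
        c l ^ (1 / s).toReal * eLpNorm (onJointSphere Ω) s (jointSphereMeasure m n) := by
      refine (eLpNorm_mono_measure _ (Measure.restrict_mono (hball l hl) le_rfl)).trans ?_
      rw [eLpNorm_congr_ae (ae_restrict_of_ae hae),
        eLpNorm_comp_measurePreserving (hmem.1.smul_measure (c l)) (hmp l hl),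
        eLpNorm_smul_measure_of_ne_zero hc0, smul_eq_mul]
    refine (mul_le_mul_right h1 _).trans (le_of_eq ?_)
    have hcl : c l = ENNReal.ofReal (m + 1) ^ (m * n) / (m * n : ℕ) *
        ENNReal.ofReal l ^ (m * n) := by
      rw [hc, hρ]
      simp only
      rw [ENNReal.ofReal_mul (by positivity), mul_pow, ENNReal.div_eq_inv_mul,
        ENNReal.div_eq_inv_mul]
      ring
    rw [hcl, ENNReal.mul_rpow_of_nonneg _ _ hτ, ENNReal.rpow_mul, ENNReal.rpow_natCast]
    ring

/-! ### Reduction of rough kernels to the fractional maximal function -/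

lemma sub_mem_ball_of_mem_closedCube {a : E n} {l : ℝ} (hl : 0 < l) {x y : E n}
    (hx : x ∈ closedCube a l) (hy : y ∈ closedCube a l) :
    x - y ∈ Metric.ball (0 : E n) ((n + 1) * l) := by
  rw [mem_ball_zero_iff, EuclideanSpace.norm_eq]
  refine (Real.sqrt_lt' (by positivity)).2 ?_
  calc ∑ i, ‖(x - y) i‖ ^ 2 ≤ ∑ _i : Fin n, l ^ 2 := by
        refine Finset.sum_le_sum fun i _ => ?_
        have h1 := hx i
        have h2 := hy i
        rw [Real.norm_eq_abs, sq_abs]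
        refine sq_le_sq' ?_ ?_ <;> simp only [PiLp.sub_apply] <;> linarith
    _ = n * l ^ 2 := by simp
    _ < ((n + 1) * l) ^ 2 := by
        have : 0 < l ^ 2 := by positivity
        have : (0 : ℝ) ≤ n := Nat.cast_nonneg n
        nlinarith [mul_nonneg (sq_nonneg (n : ℝ)) (sq_nonneg l)]

lemma enorm_finset_prod (z : Fin m → ℂ) : ‖∏ i, z i‖ₑ = ∏ i, ‖z i‖ₑ := by
  simp only [enorm_eq_nnnorm, nnnorm_prod, ENNReal.ofNNReal_finsetProd]

/-- Hölder's inequality over `Q^m`, separating the kernel from the functions. -/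
lemma lintegral_kernel_mul_le {Ω : (Fin m → E n) → ℂ} {s A : ℝ≥0∞} {s' : ℝ}
    (hs : s⁻¹ + (ENNReal.ofReal s')⁻¹ = 1) (hs' : 1 ≤ s') (hΩ : HasBoxBound Ω s A)
    {f : Fin m → E n → ℂ} (hf : ∀ i, AEStronglyMeasurable (f i) volume) {a : E n} {l : ℝ}
    (hl : 0 < l) {x : E n} (hx : x ∈ closedCube a l) :
    ∫⁻ y in Set.univ.pi (fun _ : Fin m => closedCube a l),
        ‖Ω (fun i => x - y i)‖ₑ * ∏ i, ‖f i (y i)‖ₑ ≤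
      A * ENNReal.ofReal ((n + 1) * l) ^ ((m * n : ℕ) * (1 / s).toReal) *
        (∏ i, ∫⁻ y in closedCube a l, ‖f i y‖ₑ ^ s') ^ (1 / s') := by
  set Q := closedCube a l
  set B : Set (Fin m → E n) := Set.univ.pi (fun _ : Fin m => Q) with hB
  have hBm : MeasurableSet B := MeasurableSet.univ_pi fun _ => measurableSet_closedCube a l
  set τ : (Fin m → E n) → (Fin m → E n) := fun y i => x - y i with hτ
  have hτmp : MeasurePreserving τ volume volume :=
    measurePreserving_pi (fun _ => volume) (fun _ => volume) fun _ =>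
      Measure.measurePreserving_sub_left volume x
  have hl' : 0 < (n + 1) * l := by positivity
  have hmap : Measure.map τ ((volume : Measure (Fin m → E n)).restrict B) ≤
      (volume : Measure (Fin m → E n)).restrict (ballProd m n ((n + 1) * l)) := by
    refine Measure.le_iff.2 fun t ht => ?_
    rw [Measure.map_apply hτmp.measurable ht, Measure.restrict_apply (hτmp.measurable ht),
      Measure.restrict_apply ht, ← hτmp.measure_preimage
        (ht.inter (measurableSet_ballProd m n _)).nullMeasurableSet]
    refine measure_mono fun y hy => ⟨hy.1, fun i _ => ?_⟩
    exact sub_mem_ball_of_mem_closedCube hl hx (hy.2 i (Set.mem_univ i))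
  have hΩm : AEStronglyMeasurable Ω (Measure.map τ ((volume : Measure (Fin m → E n)).restrict B)) :=
    (hΩ.aestronglyMeasurable _ hl').mono_measure hmap
  have hΩτ : AEStronglyMeasurable (Ω ∘ τ) ((volume : Measure (Fin m → E n)).restrict B) :=
    hΩm.comp_measurable hτmp.measurable
  have hF : AEStronglyMeasurable (fun y : Fin m → E n => ∏ i, f i (y i))
      ((volume : Measure (Fin m → E n)).restrict B) := by
    refine AEStronglyMeasurable.restrict (Finset.aestronglyMeasurable_fun_prod _ fun i _ => ?_)
    exact (hf i).comp_quasiMeasurePreserving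
      (Measure.quasiMeasurePreserving_eval (fun _ : Fin m => (volume : Measure (E n))) i)
  have hs0 : 0 < s' := by linarith
  have hholder : ENNReal.HolderTriple s (ENNReal.ofReal s') 1 := ⟨by rw [hs, inv_one]⟩
  calc ∫⁻ y in B, ‖Ω (fun i => x - y i)‖ₑ * ∏ i, ‖f i (y i)‖ₑ
      = eLpNorm ((Ω ∘ τ) • fun y : Fin m → E n => ∏ i, f i (y i)) 1 (volume.restrict B) := by
        rw [eLpNorm_one_eq_lintegral_enorm]
        refine lintegral_congr fun y => ?_
        rw [Pi.smul_apply', smul_eq_mul, enorm_mul, enorm_finset_prod]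
        rfl
    _ ≤ eLpNorm (Ω ∘ τ) s (volume.restrict B) *
        eLpNorm (fun y : Fin m → E n => ∏ i, f i (y i)) (ENNReal.ofReal s') (volume.restrict B) :=
        eLpNorm_smul_le_mul_eLpNorm hF hΩτ
    _ ≤ _ := by
        refine mul_le_mul' ?_ (le_of_eq ?_)
        · rw [← eLpNorm_map_measure hΩm hτmp.measurable.aemeasurable]
          exact (eLpNorm_mono_measure _ hmap).trans (hΩ.eLpNorm_le _ hl')
        · rw [eLpNorm_eq_lintegral_rpow_enorm_toReal (by simpa using hs0) ENNReal.ofReal_ne_top,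
            ENNReal.toReal_ofReal hs0.le]
          congr 1
          rw [hB, volume_pi, Measure.restrict_pi_pi,
            ← lintegral_pi_prod_eq _ fun i => ((hf i).restrict.enorm.pow_const s')]
          refine lintegral_congr fun y => ?_
          rw [enorm_finset_prod, ENNReal.prod_rpow_of_nonneg hs0.le]

/-- The maximal function with rough kernel is dominated pointwise by a power of the fractional
maximal function of powers of the functions. -/
lemma roughMaximal_le (hn : 0 < n) {Ω : (Fin m → E n) → ℂ} {s A : ℝ≥0∞} {s' α : ℝ}
    (hs : s⁻¹ + (ENNReal.ofReal s')⁻¹ = 1) (hs' : 1 ≤ s') (hΩ : HasBoxBound Ω s A)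
    {f : Fin m → E n → ℂ} (hf : ∀ i, AEStronglyMeasurable (f i) volume) (x : E n) :
    roughMaximal Ω α f x ≤
      A * ENNReal.ofReal (n + 1) ^ ((m * n : ℕ) * (1 / s).toReal) *
        fractionalMaximal (m - α * s' / n) (fun i y => ‖f i y‖ₑ ^ s') x ^ (1 / s') := by
  have hs0 : 0 < s' := by linarith
  have hτ : (1 / s).toReal = 1 - 1 / s' := by
    have h1 : (ENNReal.ofReal s')⁻¹ ≠ ∞ := by
      rw [ENNReal.inv_ne_top]
      simpa using hs0
    have h2 : s⁻¹ ≠ ∞ := fun h => by simp [h] at hs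
    have h3 := congrArg ENNReal.toReal hs
    rw [ENNReal.toReal_add h2 h1, ENNReal.toReal_inv (ENNReal.ofReal s'),
      ENNReal.toReal_ofReal hs0.le, ENNReal.toReal_one] at h3
    rw [one_div, one_div]
    linarith
  have hτ0 : 0 ≤ (1 / s).toReal := ENNReal.toReal_nonneg
  refine iSup_le fun Q => iSup_le fun hQ => iSup_le fun hx => ?_
  have hfrac : (∏ i, ∫⁻ y in Q, ‖f i y‖ₑ ^ s') / volume Q ^ ((m : ℝ) - α * s' / n) ≤
      fractionalMaximal (m - α * s' / n) (fun i y => ‖f i y‖ₑ ^ s') x :=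
    le_iSup₂_of_le (f := fun (Q : Set (E n)) (_ : IsCube Q) => ⨆ (_ : x ∈ Q),
      (∏ i, ∫⁻ y in Q, ‖f i y‖ₑ ^ s') / volume Q ^ ((m : ℝ) - α * s' / n)) Q hQ
      (le_iSup_of_le hx le_rfl)
  have hV0 := hQ.volume_ne_zero
  have hVt := hQ.volume_ne_top
  obtain ⟨a, l, hl, hQeq⟩ := hQ
  change Q = closedCube a l at hQeq
  refine le_trans ?_ (mul_le_mul_right (ENNReal.rpow_le_rpow hfrac (by positivity)) _)
  have hnum := lintegral_kernel_mul_le hs hs' hΩ hf hl (hQeq ▸ hx)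
  rw [← hQeq] at hnum
  have hV : ENNReal.ofReal l ^ ((m * n : ℕ) * (1 / s).toReal) =
      volume Q ^ (m * (1 / s).toReal) := by
    rw [hQeq, volume_closedCube, ← ENNReal.rpow_natCast, ← ENNReal.rpow_mul]
    congr 1
    push_cast
    ring
  rw [ENNReal.ofReal_mul (by positivity), ENNReal.mul_rpow_of_nonneg _ _ (by positivity),
    hV] at hnum
  refine (ENNReal.div_le_div_right hnum _).trans (le_of_eq ?_)
  have hVpow : volume Q ^ (m * (1 / s).toReal) * (volume Q ^ ((m : ℝ) - α / n))⁻¹ =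
      ((volume Q ^ ((m : ℝ) - α * s' / n))⁻¹) ^ (1 / s') := by
    rw [← ENNReal.rpow_neg, ← ENNReal.rpow_neg, ← ENNReal.rpow_mul, ← ENNReal.rpow_add _ _ hV0 hVt,
      hτ]
    congr 1
    have : (n : ℝ) ≠ 0 := by exact_mod_cast hn.ne'
    field_simp
    ring
  have hs1 : 0 ≤ 1 / s' := by positivity
  generalize (1 / s).toReal = τ at hVpow ⊢
  rw [ENNReal.div_eq_inv_mul, ENNReal.div_eq_inv_mul,
    ENNReal.mul_rpow_of_nonneg (_)⁻¹ _ hs1, ← hVpow]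
  ring

/-- The weighted estimate for all kernels with a given bound on products of balls; the powers of
the weights and of the functions reduce it to the fractional maximal function. -/
theorem exists_weightedLpNorm_roughMaximal_le (P : Fin m → ℝ) (p q α : ℝ) (s : ℝ≥0∞) (s' : ℝ)
    (hm : 0 < m) (hn : 0 < n)
    (hs : s⁻¹ + (ENNReal.ofReal s')⁻¹ = 1) (hs' : 1 ≤ s') (hP : ∀ i, s' < P i)
    (hp : 1 / p = ∑ i, 1 / P i) (hα : 0 < α) (hp0 : 0 < p) (hpn : p < n / α)
    (hq : 1 / q = 1 / p - α / n) :
    ∃ C : ℝ≥0∞, C ≠ ∞ ∧ ∀ ω : Fin m → E n → ℝ≥0, (∀ i, AEMeasurable (ω i) volume) →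
      MemAPq (fun i => P i / s') (q / s') (fun i x => (ω i x : ℝ≥0∞) ^ s') →
      ∀ (Ω : (Fin m → E n) → ℂ) (A : ℝ≥0∞), A ≠ ∞ → HasBoxBound Ω s A →
      ∀ f : Fin m → E n → ℂ, (∀ i, AEStronglyMeasurable (f i) volume) →
        weightedLpNorm q (roughMaximal Ω α f) (fun x => (∏ i, (ω i x : ℝ≥0∞)) ^ q) ≤
          C * A * APqConst (fun i => P i / s') (q / s') (fun i x => (ω i x : ℝ≥0∞) ^ s') ^ (1 / q) *
            (∏ i, AInftyConst
              (fun x => ((ω i x : ℝ≥0∞) ^ s') ^ (-(P i / s').conjExponent)) ^ (1 / P i)) *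
            ∏ i, weightedLpNorm (P i) (fun x => ‖f i x‖ₑ) (fun x => (ω i x : ℝ≥0∞) ^ P i) := by
  have hs0 : 0 < s' := by linarith
  have hPpos : ∀ i, 0 < P i := fun i => by linarith [hP i]
  have hn' : (0 : ℝ) < n := by exact_mod_cast hn
  have hqinv : 0 < 1 / q := by
    rw [hq, sub_pos, div_lt_div_iff₀ hn' hp0]
    rw [lt_div_iff₀ hα] at hpn
    linarith
  have hq0 : 0 < q := one_div_pos.1 hqinv
  set γ : ℝ := m - α * s' / n with hγdef
  -- The exponents of the reduced problem.
  have hsum : ∑ i, q / P i = q / p := by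
    rw [← mul_one_div q p, hp, Finset.mul_sum]
    simp only [mul_one_div]
  have hqp : q / p = 1 + q * (α / n) := by
    have h1 : 1 / p = 1 / q + α / n := by linarith
    rw [← mul_one_div q p, h1, mul_add, mul_one_div_cancel hq0.ne']
  have hPs : ∀ i, 1 < P i / s' := fun i => (one_lt_div hs0).2 (hP i)
  have hratio : ∀ i, q / s' / (P i / s') = q / P i := fun i => by
    have := (hPpos i).ne'
    field_simp
  have hPq : 1 ≤ ∑ i, q / s' / (P i / s') := by
    simp only [hratio]
    rw [hsum, hqp]
    have : 0 ≤ q * (α / n) := by positivity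
    linarith
  have hexp : q / s' * γ = 1 + ∑ i, q / s' / (P i / s').conjExponent := by
    have h1 : ∀ i, q / s' / (P i / s').conjExponent = q / s' - q / P i := fun i => by
      have h2 : P i - s' ≠ 0 := by linarith [hP i]
      have h3 := (hPpos i).ne'
      have h4 : P i / s' - 1 ≠ 0 := by linarith [hPs i]
      rw [Real.conjExponent]
      field_simp
    simp only [h1]
    rw [Finset.sum_sub_distrib, hsum, hqp, hγdef, Finset.sum_const, Finset.card_univ,
      Fintype.card_fin, nsmul_eq_mul]
    field_simp
    ring
  have hγ : 0 < γ := by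
    -- `α / n < 1 / p`, and each summand `1 / P i` of `1 / p` is less than `1 / s'`.
    have h1 : α / n < 1 / p := by linarith
    have h2 : 1 / p < m * (1 / s') := by
      rw [hp]
      have hne : (Finset.univ : Finset (Fin m)).Nonempty := ⟨⟨0, hm⟩, Finset.mem_univ _⟩
      calc ∑ i, 1 / P i < ∑ _i : Fin m, 1 / s' :=
            Finset.sum_lt_sum_of_nonempty hne fun i _ => one_div_lt_one_div_of_lt hs0 (hP i)
        _ = m * (1 / s') := by simp
    have h3 : α / n * s' < m := by
      have := mul_lt_mul_of_pos_right (h1.trans h2) hs0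
      rwa [mul_assoc, one_div_mul_cancel hs0.ne', mul_one] at this
    rw [hγdef, mul_div_right_comm]
    linarith
  have hγm : γ ≤ m := by
    have : 0 ≤ α * s' / n := by positivity
    rw [hγdef]
    linarith
  obtain ⟨C₀, hC₀, hmax⟩ := weightedLpNorm_fractionalMaximal_le m n hPs (div_pos hq0 hs0) hPq hγ hγm
    hexp
  set D : ℝ≥0∞ := ENNReal.ofReal (n + 1) ^ ((m * n : ℕ) * (1 / s).toReal) with hD
  have hDt : D ≠ ∞ := ENNReal.rpow_ne_top_of_nonneg (by positivity) ENNReal.ofReal_ne_top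
  have hs1 : 0 ≤ 1 / s' := by positivity
  refine ⟨D * C₀ ^ (1 / s'), ENNReal.mul_ne_top hDt (ENNReal.rpow_ne_top_of_nonneg hs1 hC₀),
    fun ω hω hA Ω A hAt hΩ f hf => ?_⟩
  have hAD : (A * D) ^ q ≠ ∞ :=
    ENNReal.rpow_ne_top_of_nonneg hq0.le (ENNReal.mul_ne_top hAt hDt)
  set g : Fin m → E n → ℝ≥0∞ := fun i y => ‖f i y‖ₑ ^ s' with hg
  have hbound := hmax (fun i x => (ω i x : ℝ≥0∞) ^ s')
    (fun i => (hω i).coe_nnreal_ennreal.pow_const _)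
    (fun i x => ENNReal.rpow_ne_top_of_nonneg hs0.le ENNReal.coe_ne_top) hA g
    (fun i => (hf i).enorm.pow_const _)
  have hweight : ∀ x, (∏ i, (ω i x : ℝ≥0∞) ^ s') ^ (q / s') =
      (∏ i, (ω i x : ℝ≥0∞)) ^ q := fun x => by
    rw [ENNReal.prod_rpow_of_nonneg hs0.le, ← ENNReal.rpow_mul, mul_div_cancel₀ _ hs0.ne']
  have hnorm : ∀ i, weightedLpNorm (P i / s') (g i) (fun x => ((ω i x : ℝ≥0∞) ^ s') ^ (P i / s')) ^
      (1 / s') = weightedLpNorm (P i) (fun x => ‖f i x‖ₑ) (fun x => (ω i x : ℝ≥0∞) ^ P i) :=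
    fun i => by
      have h1 := (hPpos i).ne'
      simp only [weightedLpNorm, hg, ← ENNReal.rpow_mul]
      rw [mul_div_cancel₀ _ hs0.ne']
      congr 1
      field_simp
  calc weightedLpNorm q (roughMaximal Ω α f) (fun x => (∏ i, (ω i x : ℝ≥0∞)) ^ q)
      ≤ (∫⁻ x, (A * D) ^ q * (fractionalMaximal γ g x ^ (q / s') *
          (∏ i, (ω i x : ℝ≥0∞)) ^ q)) ^ (1 / q) := by
        refine ENNReal.rpow_le_rpow (lintegral_mono fun x => ?_) hqinv.le
        simp only
        rw [← mul_assoc]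
        refine mul_le_mul_left ?_ _
        refine (ENNReal.rpow_le_rpow (roughMaximal_le hn hs hs' hΩ hf x) hq0.le).trans (le_of_eq ?_)
        rw [ENNReal.mul_rpow_of_nonneg _ _ hq0.le, ← ENNReal.rpow_mul, one_div_mul_eq_div]
    _ = A * D * weightedLpNorm (q / s') (fractionalMaximal γ g)
          (fun x => (∏ i, (ω i x : ℝ≥0∞) ^ s') ^ (q / s')) ^ (1 / s') := by
        rw [lintegral_const_mul' _ _ hAD, ENNReal.mul_rpow_of_nonneg _ _ hqinv.le,
          ← ENNReal.rpow_mul, mul_one_div_cancel hq0.ne', ENNReal.rpow_one]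
        simp only [weightedLpNorm, hweight]
        rw [← ENNReal.rpow_mul]
        congr 2
        field_simp
    _ ≤ A * D * (C₀ * APqConst (fun i => P i / s') (q / s') (fun i x => (ω i x : ℝ≥0∞) ^ s') ^
          (1 / (q / s')) * (∏ i, AInftyConst
            (fun x => ((ω i x : ℝ≥0∞) ^ s') ^ (-(P i / s').conjExponent)) ^ (1 / (P i / s'))) *
          ∏ i, weightedLpNorm (P i / s') (g i)
            (fun x => ((ω i x : ℝ≥0∞) ^ s') ^ (P i / s'))) ^ (1 / s') := by
        gcongr
    _ = _ := by
        have e1 : 1 / (q / s') * (1 / s') = 1 / q := by field_simp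
        have e2 : ∀ i, 1 / (P i / s') * (1 / s') = 1 / P i := fun i => by
          have h1 := (hPpos i).ne'
          field_simp
        have e3 : ∀ i (y : ℝ≥0∞), (y ^ (1 / (P i / s'))) ^ (1 / s') = y ^ (1 / P i) := fun i y => by
          rw [← ENNReal.rpow_mul, e2]
        rw [ENNReal.mul_rpow_of_nonneg _ _ hs1, ENNReal.mul_rpow_of_nonneg _ _ hs1,
          ENNReal.mul_rpow_of_nonneg _ _ hs1, ← ENNReal.prod_rpow_of_nonneg hs1,
          ← ENNReal.prod_rpow_of_nonneg hs1]
        simp only [hnorm, e3]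
        rw [← ENNReal.rpow_mul (APqConst _ _ _), e1]
        ring

end RoughFractional

end

theorem theorem1p1 (m n : ℕ) (P : Fin m → ℝ) (p q α : ℝ) (s : ℝ≥0∞) (s' : ℝ)
    (hs : s⁻¹ + (ENNReal.ofReal s')⁻¹ = 1) (hs' : 1 ≤ s') (hP : ∀ i, s' < P i)
    (hp : 1 / p = ∑ i, 1 / P i) (hα : 0 < α) (hαmn : α < (m : ℝ) * n)
    (hmp : 1 / (m : ℝ) < p) (hpn : p < n / α) (hq : 1 / q = 1 / p - α / n) :
    ∃ C : ℝ≥0, ∀ ω : Fin m → RoughFractional.E n → ℝ≥0,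
      (∀ i, AEMeasurable (ω i) volume) →
      RoughFractional.MemAPq (fun i => P i / s') (q / s')
        (fun i x => (ω i x : ℝ≥0∞) ^ s') →
      ∀ (Ω : (Fin m → RoughFractional.E n) → ℂ) (f : Fin m → RoughFractional.E n → ℂ),
        (∀ i, AEStronglyMeasurable (f i) volume) →
        (RoughFractional.SeparatelyHomogeneous Ω →
          MemLp (RoughFractional.onProdSphere Ω) s (RoughFractional.prodSphereMeasure m n) →
          RoughFractional.weightedLpNorm q (RoughFractional.roughMaximal Ω α f)
              (fun x => (∏ i, (ω i x : ℝ≥0∞)) ^ q) ≤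
            C * eLpNorm (RoughFractional.onProdSphere Ω) s
                (RoughFractional.prodSphereMeasure m n) *
              RoughFractional.APqConst (fun i => P i / s') (q / s')
                (fun i x => (ω i x : ℝ≥0∞) ^ s') ^ (1 / q) *
              (∏ i, RoughFractional.AInftyConst
                (fun x => ((ω i x : ℝ≥0∞) ^ s') ^ (-(P i / s').conjExponent)) ^ (1 / P i)) *
              ∏ i, RoughFractional.weightedLpNorm (P i) (fun x => ‖f i x‖ₑ)
                (fun x => (ω i x : ℝ≥0∞) ^ P i)) ∧
        (RoughFractional.JointlyHomogeneous Ω →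
          MemLp (RoughFractional.onJointSphere Ω) s (RoughFractional.jointSphereMeasure m n) →
          RoughFractional.weightedLpNorm q (RoughFractional.roughMaximal Ω α f)
              (fun x => (∏ i, (ω i x : ℝ≥0∞)) ^ q) ≤
            C * eLpNorm (RoughFractional.onJointSphere Ω) s
                (RoughFractional.jointSphereMeasure m n) *
              RoughFractional.APqConst (fun i => P i / s') (q / s')
                (fun i x => (ω i x : ℝ≥0∞) ^ s') ^ (1 / q) *
              (∏ i, RoughFractional.AInftyConst
                (fun x => ((ω i x : ℝ≥0∞) ^ s') ^ (-(P i / s').conjExponent)) ^ (1 / P i)) *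
              ∏ i, RoughFractional.weightedLpNorm (P i) (fun x => ‖f i x‖ₑ)
                (fun x => (ω i x : ℝ≥0∞) ^ P i)) := by
  have hmn : 0 < (m : ℝ) * n := hα.trans hαmn
  have hm : 0 < m := Nat.pos_of_ne_zero fun h => by simp [h] at hmn
  have hn : 0 < n := Nat.pos_of_ne_zero fun h => by simp [h] at hmn
  have hp0 : 0 < p := lt_of_le_of_lt (by positivity) hmp
  obtain ⟨C₀, hC₀, hmain⟩ := RoughFractional.exists_weightedLpNorm_roughMaximal_le P p q α s s'
    hm hn hs hs' hP hp hα hp0 hpn hq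
  obtain ⟨D₁, hD₁, hsep⟩ := RoughFractional.SeparatelyHomogeneous.exists_hasBoxBound m n hn s
  obtain ⟨D₂, hD₂, hjoint⟩ := RoughFractional.JointlyHomogeneous.exists_hasBoxBound m n hm hn s
  have hC : C₀ * (D₁ + D₂) ≠ ∞ := ENNReal.mul_ne_top hC₀ (ENNReal.add_ne_top.2 ⟨hD₁, hD₂⟩)
  refine ⟨(C₀ * (D₁ + D₂)).toNNReal, fun ω hω hA Ω f hf => ⟨fun hΩ hmem => ?_, fun hΩ hmem => ?_⟩⟩
  · refine (hmain ω hω hA Ω _ (ENNReal.mul_ne_top hD₁ hmem.2.ne) (hsep Ω hΩ hmem) f hf).trans ?_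
    rw [ENNReal.coe_toNNReal hC, ← mul_assoc C₀]
    gcongr
    exact le_self_add
  · refine (hmain ω hω hA Ω _ (ENNReal.mul_ne_top hD₂ hmem.2.ne) (hjoint Ω hΩ hmem) f hf).trans ?_
    rw [ENNReal.coe_toNNReal hC, ← mul_assoc C₀]
    gcongr
    exact le_add_self
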